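/- **Setting.** For $k,\sigma,L,\delta,\hat L>0$, $a_1\in\mathbb R$ and $N\ge 2$ consider the strip-wise subdomains $\Omega_j=(a_j,b_j)\times(0,\hat L)$, $j=1,\dots,N$, with $a_j=a_1+(j-1)L$, $b_j=a_j+L+2\delta$, and the parallel Schwarz method with impedance conditions ($\alpha=ik$) for the 2D Helmholtz equation $(ik\sigma-k^2)u-\Delta u=f$ with homogeneous Dirichlet conditions at $y\in\{0,\hat L\}$. Expanding the local errors in $\sin(\tilde k y)$, $\tilde k=m\pi/\hat L$, $m=1,2,\dots$, the method decouples: for each $\tilde k$ the new mode errors $w_j$ are obtained from the old ones $v_j$ by $$(ik\sigma+\tilde k^2-k^2)w_j-w_j''=0\ \text{ on }(a_j,b_j),\qquad \mathcal B_l w_j(a_j)=\mathcal B_l v_{j-1}(a_j)\ (j\ge2),\qquad \mathcal B_r w_j(b_j)=\mathcal B_r v_{j+1}(b_j)\ (j\le N-1),$$ $\mathcal B_l w_1(a_1)=0$, $\mathcal B_r w_N(b_N)=0$, where $\mathcal B_l u=-u'+ik\,u$, $\mathcal B_r u=u'+ik\,u$. Put $\zeta=\sqrt{ik\sigma+\tilde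 k^2-k^2}$ (principal branch), $D=(\zeta+ik)^2e^{\zeta(2\delta+L)}-(\zeta-ik)^2e^{-\zeta(2\delta+L)}$, $$a=\frac{(\zeta+ik)^2e^{2\zeta\delta}-(\zeta-ik)^2e^{-2\zeta\delta}}{D},\qquad b=-\frac{(\zeta^2-(ik)^2)(e^{\zeta L}-e^{-\zeta L})}{D},$$ and let $\mathcal T_N(\tilde k)\in\mathbb C^{2(N-1)\times 2(N-1)}$ be the block tridiagonal block Toeplitz matrix with diagonal, super- and subdiagonal blocks $\begin{pmatrix}0&b\\b&0\end{pmatrix}$, $\begin{pmatrix}a&0\\0&0\end{pmatrix}$, $\begin{pmatrix}0&0\\0&a\end{pmatrix}$. Define $$R^{\mathrm H}_{1d}(\tilde k)=\lim_{N\to\infty}\rho(\mathcal T_N(\tilde k)),\qquad R^{\mathrm H}_{2d}=\sup_{m\ge1}R^{\mathrm H}_{1d}(m\pi/\hat L).$$ **Corollary 4.2.** Let $\sigma_0>0$. For $L_0,\delta_0>0$ and $k>0$ take $\sigma=\sigma_0k$, $L=L_0/k$, $\delta=\delta_0/k$. (A) For all $L_0,\delta_0>0$: 1. For all $k,\tilde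 k>0$, $a_1\in\mathbb R$ and $N\ge2$, one Schwarz iteration of the mode $\tilde k$ is always solvable, and it acts on the vector of Robin interface data $[R_+(b_1),R_-(a_2),R_+(b_2),\dots,R_+(b_{N-1}),R_-(a_N)]^T$, where for a family $(u_j)$ we write $R_+(b_j)=\mathcal B_ru_{j+1}(b_j)$ and $R_-(a_j)=\mathcal B_lu_{j-1}(a_j)$, as multiplication by $\mathcal T_N(\tilde k)$. 2. For all $k,\tilde k>0$ the limit defining $R^{\mathrm H}_{1d}(\tilde k)$ exists. It depends on $k$ and $\tilde k$ only through $\beta=\tilde k^2/k^2$; write it as $r(\beta)$ (equivalently, $r(\beta)$ is its value for $k=1$, $\tilde k=\sqrt\beta$). 3. The value $S=S(\sigma_0,L_0,\delta_0)=\sup_{\beta>0}r(\beta)$, which does not depend on $k$ or $\hat L$, is finite, and for all $\hat L,k>0$ the supremum $R^{\mathrm H}_{2d}$ is finite with $R^{\mathrm H}_{2d}\le S$. 4. The bound is tight as $k\to\infty$: for every $\hat L>0$, $R^{\mathrm H}_{2d}\to S$ as $k\to\infty$. (B) If, in addition, $\sigma_0,L_0,\delta_0$ are between them sufficiently large, then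 the method is $k$-robust and scalable in $N$. Precisely: there is $M$, depending only on $\sigma_0$, such that for all $L_0,\delta_0>0$ with $\sigma_0\ge1$ or $L_0\ge M$ or $\delta_0\ge M$ one has $S<1$, and there are $q<1$ and $N_0$ (depending only on $\sigma_0,L_0,\delta_0$) such that $\rho(\mathcal T_N(m\pi/\hat L))\le q$ for all $N\ge N_0$, $\hat L>0$, $k>0$ and $m\ge1$. -/

import Mathlib

open Filter Topology

noncomputable section

namespace Schwarz

/-! ### The block Toeplitz matrix -/

/-- The `2m × 2m` block tridiagonal block Toeplitz matrix with diagonal blocks `[[0, b], [b, 0]]`,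
superdiagonal blocks `[[a, 0], [0, 0]]` and subdiagonal blocks `[[0, 0], [0, a]]`.
The index `(i, r)` is row (column) `r` of the `i`-th block. -/
def blockToeplitz (a b : ℂ) (m : ℕ) : Matrix (Fin m × Fin 2) (Fin m × Fin 2) ℂ :=
  Matrix.of fun p q =>
    if q.1 = p.1 then (!![0, b; b, 0] : Matrix (Fin 2) (Fin 2) ℂ) p.2 q.2
    else if (q.1 : ℕ) = (p.1 : ℕ) + 1 then (!![a, 0; 0, 0] : Matrix (Fin 2) (Fin 2) ℂ) p.2 q.2
    else if (p.1 : ℕ) = (q.1 : ℕ) + 1 then (!![0, 0; 0, a] : Matrix (Fin 2) (Fin 2) ℂ) p.2 q.2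
    else 0

/-! ### Coefficients for the Helmholtz equation with impedance parameter `α = i k` -/

/-- `ζ(k̃) = √(i k σ + k̃² - k²)`, principal branch. -/
def zeta (k σ kt : ℝ) : ℂ := Complex.sqrt (Complex.I * k * σ + kt ^ 2 - k ^ 2)

/-- The common denominator of the two coefficients. -/
def coeffDen (k σ L δ kt : ℝ) : ℂ :=
  (zeta k σ kt + Complex.I * k) ^ 2 * Complex.exp (zeta k σ kt * (2 * δ + L))
    - (zeta k σ kt - Complex.I * k) ^ 2 * Complex.exp (-(zeta k σ kt * (2 * δ + L)))

/-- The coefficient `a` of the iteration matrix. -/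
def coeffA (k σ L δ kt : ℝ) : ℂ :=
  ((zeta k σ kt + Complex.I * k) ^ 2 * Complex.exp (2 * zeta k σ kt * δ)
    - (zeta k σ kt - Complex.I * k) ^ 2 * Complex.exp (-(2 * zeta k σ kt * δ)))
    / coeffDen k σ L δ kt

/-- The coefficient `b` of the iteration matrix. -/
def coeffB (k σ L δ kt : ℝ) : ℂ :=
  -((zeta k σ kt ^ 2 - (Complex.I * k) ^ 2)
      * (Complex.exp (zeta k σ kt * L) - Complex.exp (-(zeta k σ kt * L))))
    / coeffDen k σ L δ kt

/-- The Schwarz iteration matrix for `N` subdomains and the Fourier number `kt`; it has `N - 1`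
blocks, one for each pair of consecutive subdomains. -/
def iterMatrix (k σ L δ kt : ℝ) (N : ℕ) :
    Matrix (Fin (N - 1) × Fin 2) (Fin (N - 1) × Fin 2) ℂ :=
  blockToeplitz (coeffA k σ L δ kt) (coeffB k σ L δ kt) (N - 1)

/-- The spectral radius of the iteration matrix, as a real number. -/
def iterRadius (k σ L δ kt : ℝ) (N : ℕ) : ℝ :=
  (spectralRadius ℂ (iterMatrix k σ L δ kt N)).toReal

/-- The convergence factor of one Fourier mode: `lim_{N → ∞}` of the spectral radius. -/
def factor1d (k σ L δ kt : ℝ) : ℝ :=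
  limUnder atTop fun N : ℕ => iterRadius k σ L δ kt N

/-- The convergence factor of the two-dimensional problem on a strip of height `Lhat`: the supremum
over the Fourier numbers `m π / Lhat`, `m = 1, 2, …`. -/
def factor2d (Lhat k σ L δ : ℝ) : ℝ :=
  ⨆ m : ℕ+, factor1d k σ L δ ((m : ℕ) * Real.pi / Lhat)

/-- The wave-number-free value: the supremum over all `β = (k̃ / k)² > 0` of the convergence factor
of one mode, with the scaled parameters taken at `k = 1`. -/
def supFactor (σ₀ L₀ δ₀ : ℝ) : ℝ :=
  ⨆ β : Set.Ioi (0 : ℝ), factor1d 1 σ₀ L₀ δ₀ (Real.sqrt β)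

/-! ### The parallel Schwarz method for one Fourier mode of the error

Subdomains are numbered `j = 1, …, N`, and subdomain `j` is the interval `[a_j, b_j]` with
`a_j = a₁ + (j - 1) L` and `b_j = a_j + L + 2 δ`. A family of local functions is a map
`u : ℕ → ℝ → ℂ` of which only the members `u 1, …, u N` matter. -/

/-- The left end point `a_j`. -/
def leftEnd (a₁ L : ℝ) (j : ℕ) : ℝ := a₁ + ((j : ℝ) - 1) * L

/-- The right end point `b_j`. -/
def rightEnd (a₁ L δ : ℝ) (j : ℕ) : ℝ := leftEnd a₁ L j + L + 2 * δ

/-- The closed subdomain `[a_j, b_j]`. -/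
def subdomain (a₁ L δ : ℝ) (j : ℕ) : Set ℝ := Set.Icc (leftEnd a₁ L j) (rightEnd a₁ L δ j)

/-- `(B_l u_j)(x) = -u_j'(x) + i k u_j(x)` for `x` in subdomain `j` (one-sided derivative at its
end points). -/
def robinLeft (a₁ k L δ : ℝ) (u : ℕ → ℝ → ℂ) (j : ℕ) (x : ℝ) : ℂ :=
  -derivWithin (u j) (subdomain a₁ L δ j) x + Complex.I * k * u j x

/-- `(B_r u_j)(x) = u_j'(x) + i k u_j(x)` for `x` in subdomain `j`. -/
def robinRight (a₁ k L δ : ℝ) (u : ℕ → ℝ → ℂ) (j : ℕ) (x : ℝ) : ℂ :=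
  derivWithin (u j) (subdomain a₁ L δ j) x + Complex.I * k * u j x

/-- `w` is the family of local errors obtained from the family `v` by one iteration of the parallel
Schwarz method with `N` subdomains, for the Fourier mode `kt`. -/
structure IsSweep (a₁ k σ L δ kt : ℝ) (N : ℕ) (v w : ℕ → ℝ → ℂ) : Prop where
  smooth : ∀ j, 1 ≤ j → j ≤ N → ContDiffOn ℝ 2 (w j) (subdomain a₁ L δ j)
  ode : ∀ j, 1 ≤ j → j ≤ N → ∀ x ∈ Set.Ioo (leftEnd a₁ L j) (rightEnd a₁ L δ j),
    (Complex.I * k * σ + kt ^ 2 - k ^ 2) * w j x - deriv (deriv (w j)) x = 0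
  left : ∀ j, 2 ≤ j → j ≤ N →
    robinLeft a₁ k L δ w j (leftEnd a₁ L j) = robinLeft a₁ k L δ v (j - 1) (leftEnd a₁ L j)
  right : ∀ j, 1 ≤ j → j + 1 ≤ N →
    robinRight a₁ k L δ w j (rightEnd a₁ L δ j) = robinRight a₁ k L δ v (j + 1) (rightEnd a₁ L δ j)
  left_end : robinLeft a₁ k L δ w 1 (leftEnd a₁ L 1) = 0
  right_end : robinRight a₁ k L δ w N (rightEnd a₁ L δ N) = 0

/-- The vector of Robin interface data
`[R₊(b_1), R₋(a_2), R₊(b_2), R₋(a_3), …, R₊(b_{N-1}), R₋(a_N)]`, where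
`R₊(b_j) = (B_r u_{j+1})(b_j)` and `R₋(a_{j+1}) = (B_l u_j)(a_{j+1})`; the block with index `i`
holds `R₊(b_j)` and `R₋(a_{j+1})` for `j = i + 1`. -/
def interfaceData (a₁ k L δ : ℝ) (N : ℕ) (u : ℕ → ℝ → ℂ) : Fin (N - 1) × Fin 2 → ℂ := fun p =>
  if p.2 = 0 then robinRight a₁ k L δ u ((p.1 : ℕ) + 2) (rightEnd a₁ L δ ((p.1 : ℕ) + 1))
  else robinLeft a₁ k L δ u ((p.1 : ℕ) + 1) (leftEnd a₁ L ((p.1 : ℕ) + 2))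

end Schwarz

end

noncomputable section

namespace Schwarz

/-! ### The spectrum of the block Toeplitz matrix -/

/-! Group the interface data as pairs (X_i, Y_i), 0 ≤ i ≤ m = N - 1, where the i-th pair is what
enters subdomain i + 1 from its two sides; the homogeneous outer conditions supply X_m = Y_0 = 0.
The matrix applies the symmetric block [[a, b], [b, a]] to each pair and only relocates the results.
Hence every eigenvalue has modulus at most max |a ± b|, for every N. Conversely, sine eigenvectors
reduce the eigenvalue problem to one scalar equation, and the implicit function theorem produces
eigenvalues tending to a + b and to a - b (`exists_tendsto_mem_spectrum`). So the limit is
`modeRate` = max |a ± b|, approached from below.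

The numbers a ± b are quotients of impedance traces of cosh(ζx) and sinh(ζx), with x measured from
the midpoint of a subdomain: the trace at δ - L/2 over the trace at δ + L/2 (`coeffA_add_coeffB`,
`coeffA_sub_coeffB`). Comparing squared moduli, both quotients are below 1 once `DampingDominates`
holds. At k = 1, with ζ = ξ + iη and κ the Fourier number, 2ξη = σ and ξ² - η² = κ² - 1; these
relations and elementary bounds on sin and sinh give that inequality for every κ when one of σ, L, δ
is large (`dampingDominates_zeta`). Since `modeRate` is continuous in κ and tends to 0 at infinity,
the pointwise strict bound yields S < 1.

The scaling leaves ζL and ζδ unchanged, so only κ = k̃/k matters; the values mπ/(L̂k) fill the half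
line as k grows, which gives tightness. The link to the Schwarz method is explicit: local solutions
are sums of two exponentials, and the local system has determinant ±D, nonzero because |ζ - ik| < |ζ
+ ik|. -/

/-- The vector whose `i`-th block is `(X i, Y (i + 1))`. -/
def interleave (X Y : ℕ → ℂ) (m : ℕ) : Fin m × Fin 2 → ℂ := fun p =>
  if p.2 = 0 then X p.1 else Y (p.1 + 1)

theorem exists_eq_interleave {m : ℕ} (v : Fin m × Fin 2 → ℂ) :
    ∃ X Y : ℕ → ℂ, X m = 0 ∧ Y 0 = 0 ∧ v = interleave X Y m := by
  refine ⟨fun i => if h : i < m then v (⟨i, h⟩, 0) else 0,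
    fun i => if h : 0 < i ∧ i - 1 < m then v (⟨i - 1, h.2⟩, 1) else 0, by simp, by simp, ?_⟩
  ext ⟨i, r⟩
  fin_cases r <;> simp [interleave]

/-- The matrix acts on interleaved sequences by mixing the two entries of the same index. -/
theorem blockToeplitz_mulVec_interleave (a b : ℂ) {m : ℕ} {X Y : ℕ → ℂ} (hX : X m = 0)
    (hY : Y 0 = 0) :
    (blockToeplitz a b m).mulVec (interleave X Y m) =
      interleave (fun i => b * Y (i + 1) + a * X (i + 1))
        (fun i => b * X (i - 1) + a * Y (i - 1)) m := by
  ext ⟨i, r⟩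
  have hi := i.2
  simp only [Matrix.mulVec, dotProduct, Fintype.sum_prod_type, Fin.sum_univ_two]
  fin_cases r
  · have h : ∀ q : Fin m,
        blockToeplitz a b m (i, 0) (q, 0) * interleave X Y m (q, 0) +
          blockToeplitz a b m (i, 0) (q, 1) * interleave X Y m (q, 1) =
        (fun j : ℕ => (if j = i then b * Y (j + 1) else 0) + if j = i + 1 then a * X j else 0)
          (q : ℕ) := by
      intro q
      by_cases h1 : q = i
      · subst h1; simp [blockToeplitz, interleave]
      · have h1' : (q : ℕ) ≠ i := fun h => h1 (Fin.ext h)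
        by_cases h2 : (q : ℕ) = i + 1
        · simp [blockToeplitz, interleave, h1, h2]
        · by_cases h3 : (i : ℕ) = q + 1
          · have h2' : ¬ (q : ℕ) = q + 1 + 1 := by omega
            simp [blockToeplitz, h1, h3, h2']
          · simp [blockToeplitz, h1, h1', h2, h3]
    simp only [Fin.zero_eta]
    refine (Finset.sum_congr rfl fun q _ => h q).trans
      ((Fin.sum_univ_eq_sum_range (fun j : ℕ => (if j = i then b * Y (j + 1) else 0) +
        if j = i + 1 then a * X j else 0) m).trans ?_)
    rw [Finset.sum_add_distrib,
      Finset.sum_ite_eq', Finset.sum_ite_eq']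
    by_cases h4 : (i : ℕ) + 1 < m
    · simp [interleave, h4]
    · have : (i : ℕ) + 1 = m := by omega
      simp [interleave, this, hX]
  · have h : ∀ q : Fin m,
        blockToeplitz a b m (i, 1) (q, 0) * interleave X Y m (q, 0) +
          blockToeplitz a b m (i, 1) (q, 1) * interleave X Y m (q, 1) =
        (fun j : ℕ => (if j = i then b * X j else 0) + if j + 1 = i then a * Y (j + 1) else 0)
          (q : ℕ) := by
      intro q
      by_cases h1 : q = i
      · subst h1; simp [blockToeplitz, interleave]
      · have h1' : (q : ℕ) ≠ i := fun h => h1 (Fin.ext h)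
        by_cases h2 : (q : ℕ) = i + 1
        · have h3 : ¬ (i : ℕ) + 1 + 1 = i := by omega
          simp [blockToeplitz, h1, h2, h3]
        · by_cases h3 : (i : ℕ) = q + 1
          · have h2' : ¬ (q : ℕ) = q + 1 + 1 := by omega
            simp [blockToeplitz, interleave, h1, h3, h2']
          · have h3' : ¬ (q : ℕ) + 1 = i := fun h => h3 h.symm
            simp [blockToeplitz, h1, h1', h2, h3, h3']
    simp only [Fin.mk_one]
    refine (Finset.sum_congr rfl fun q _ => h q).trans
      ((Fin.sum_univ_eq_sum_range (fun j : ℕ => (if j = i then b * X j else 0) +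
        if j + 1 = i then a * Y (j + 1) else 0) m).trans ?_)
    rw [Finset.sum_add_distrib,
      Finset.sum_ite_eq']
    have h5 : ∑ j ∈ Finset.range m, (if j + 1 = (i : ℕ) then a * Y (j + 1) else 0) = a * Y i := by
      rcases Nat.eq_zero_or_pos (i : ℕ) with h0 | h0
      · simp [h0, hY]
      · rw [Finset.sum_eq_single ((i : ℕ) - 1)]
        · rw [if_pos (by omega), Nat.sub_add_cancel h0]
        · intro j _ hj
          rw [if_neg (by omega)]
        · intro h
          simp only [Finset.mem_range] at h
          omega
    rw [h5]
    simp [interleave]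

theorem sum_normSq_interleave (X Y : ℕ → ℂ) (m : ℕ) :
    ∑ p, ‖interleave X Y m p‖ ^ 2 =
      ∑ i ∈ Finset.range m, ‖X i‖ ^ 2 + ∑ i ∈ Finset.range m, ‖Y (i + 1)‖ ^ 2 := by
  rw [Fintype.sum_prod_type]
  simp only [Fin.sum_univ_two, Finset.sum_add_distrib]
  rw [← Fin.sum_univ_eq_sum_range (fun i => ‖X i‖ ^ 2),
    ← Fin.sum_univ_eq_sum_range (fun i => ‖Y (i + 1)‖ ^ 2)]
  simp [interleave]

/-- The symmetric matrix `[[a, b], [b, a]]` has norm `max |a + b| |a - b|`. -/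
theorem normSq_mix_le (a b x y : ℂ) :
    ‖a * x + b * y‖ ^ 2 + ‖b * x + a * y‖ ^ 2 ≤
      max ‖a + b‖ ‖a - b‖ ^ 2 * (‖x‖ ^ 2 + ‖y‖ ^ 2) := by
  have e1 := parallelogram_law_with_norm ℝ (a * x + b * y) (b * x + a * y)
  have e2 := parallelogram_law_with_norm ℝ x y
  rw [show a * x + b * y + (b * x + a * y) = (a + b) * (x + y) by ring,
    show a * x + b * y - (b * x + a * y) = (a - b) * (x - y) by ring, norm_mul, norm_mul] at e1
  have h1 : ‖a + b‖ ^ 2 ≤ max ‖a + b‖ ‖a - b‖ ^ 2 := by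
    gcongr; exact le_max_left _ _
  have h2 : ‖a - b‖ ^ 2 ≤ max ‖a + b‖ ‖a - b‖ ^ 2 := by
    gcongr; exact le_max_right _ _
  have h3 := mul_le_mul_of_nonneg_right h1 (sq_nonneg ‖x + y‖)
  have h4 := mul_le_mul_of_nonneg_right h2 (sq_nonneg ‖x - y‖)
  nlinarith

theorem sum_normSq_mulVec_le (a b : ℂ) {m : ℕ} (v : Fin m × Fin 2 → ℂ) :
    ∑ p, ‖(blockToeplitz a b m).mulVec v p‖ ^ 2 ≤
      max ‖a + b‖ ‖a - b‖ ^ 2 * ∑ p, ‖v p‖ ^ 2 := by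
  obtain ⟨X, Y, hX, hY, rfl⟩ := exists_eq_interleave v
  rw [blockToeplitz_mulVec_interleave a b hX hY, sum_normSq_interleave, sum_normSq_interleave]
  simp only [Nat.add_sub_cancel]
  -- There are m + 1 pairs for m blocks: the extra slots are the zeros X m and Y 0. On the image
  -- side, the two outputs that would leave the chain at its ends are nonnegative and are dropped.
  have h := Finset.sum_le_sum fun i (_ : i ∈ Finset.range (m + 1)) =>
    normSq_mix_le a b (X i) (Y i)
  rw [← Finset.mul_sum, Finset.sum_add_distrib, Finset.sum_add_distrib,
    Finset.sum_range_succ' (fun i => ‖a * X i + b * Y i‖ ^ 2),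
    Finset.sum_range_succ (fun i => ‖b * X i + a * Y i‖ ^ 2),
    Finset.sum_range_succ (fun i => ‖X i‖ ^ 2), Finset.sum_range_succ' (fun i => ‖Y i‖ ^ 2),
    hX, hY] at h
  simp only [norm_zero, ne_eq, OfNat.ofNat_ne_zero, not_false_eq_true, zero_pow, add_zero] at h
  have e : ∑ i ∈ Finset.range m, ‖b * Y (i + 1) + a * X (i + 1)‖ ^ 2 =
      ∑ i ∈ Finset.range m, ‖a * X (i + 1) + b * Y (i + 1)‖ ^ 2 := by
    simp only [add_comm]
  rw [e]
  have := sq_nonneg ‖a * X 0 + b * 0‖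
  have := sq_nonneg ‖b * 0 + a * Y m‖
  linarith

theorem mem_spectrum_iff_mulVec {n : Type*} [Fintype n] [DecidableEq n] (A : Matrix n n ℂ)
    (l : ℂ) : l ∈ spectrum ℂ A ↔ ∃ v, v ≠ 0 ∧ A.mulVec v = l • v := by
  rw [← Matrix.spectrum_toLin', ← Module.End.hasEigenvalue_iff_mem_spectrum]
  constructor
  · intro h
    obtain ⟨v, hv⟩ := h.exists_hasEigenvector
    exact ⟨v, hv.2, by simpa using hv.apply_eq_smul⟩
  · rintro ⟨v, hv, h⟩
    exact Module.End.hasEigenvalue_of_hasEigenvector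
      (x := v) ⟨Module.End.mem_eigenspace_iff.2 (by simpa using h), hv⟩

theorem norm_le_of_mem_spectrum_blockToeplitz {a b l : ℂ} {m : ℕ}
    (h : l ∈ spectrum ℂ (blockToeplitz a b m)) : ‖l‖ ≤ max ‖a + b‖ ‖a - b‖ := by
  obtain ⟨v, hv, h⟩ := (mem_spectrum_iff_mulVec _ _).1 h
  have h1 := sum_normSq_mulVec_le a b v
  rw [h] at h1
  simp only [Pi.smul_apply, smul_eq_mul, norm_mul, mul_pow] at h1
  rw [← Finset.mul_sum] at h1
  have hpos : 0 < ∑ p, ‖v p‖ ^ 2 := by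
    obtain ⟨p, hp⟩ := Function.ne_iff.1 hv
    refine Finset.sum_pos' (fun _ _ => by positivity) ⟨p, Finset.mem_univ _, ?_⟩
    have := norm_pos_iff.2 hp
    positivity
  exact le_of_sq_le_sq (le_of_mul_le_mul_right h1 hpos) (le_max_of_le_left (norm_nonneg _))

theorem spectralRadius_blockToeplitz_le (a b : ℂ) (m : ℕ) :
    spectralRadius ℂ (blockToeplitz a b m) ≤ ENNReal.ofReal (max ‖a + b‖ ‖a - b‖) := by
  refine iSup₂_le fun l hl => ?_
  rw [← enorm_eq_nnnorm, ← ofReal_norm]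
  exact ENNReal.ofReal_le_ofReal (norm_le_of_mem_spectrum_blockToeplitz hl)

/-- A sine sequence is an eigenvector as soon as the condition at the left boundary holds. -/
theorem mem_spectrum_blockToeplitz {a b l θ : ℂ} {m : ℕ} (hm : 1 ≤ m) (hb : b ≠ 0)
    (hθ : Complex.sin θ ≠ 0) (hl : l ^ 2 + a ^ 2 - b ^ 2 = 2 * a * l * Complex.cos θ)
    (h0 : l * Complex.sin ((m + 1) * θ) = a * Complex.sin (m * θ)) :
    l ∈ spectrum ℂ (blockToeplitz a b m) := by
  rw [mem_spectrum_iff_mulVec]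
  -- Integer indices are needed because the condition Y 0 = 0 involves S (-1).
  set S : ℤ → ℂ := fun i => Complex.sin ((m - i) * θ) with hS
  have hrec : ∀ i, S (i - 1) + S (i + 1) = 2 * Complex.cos θ * S i := by
    intro i
    simp only [hS]
    push_cast
    rw [show ((m : ℂ) - (i - 1)) * θ = (m - i) * θ + θ by ring,
      show ((m : ℂ) - (i + 1)) * θ = (m - i) * θ - θ by ring, Complex.sin_add, Complex.sin_sub]
    ring
  have hX : S m = 0 := by simp [hS]
  have hY : (l * S (-1) - a * S 0) / b = 0 := by
    have e1 : S (-1) = Complex.sin ((m + 1) * θ) := by simp [hS]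
    have e2 : S 0 = Complex.sin (m * θ) := by simp [hS]
    rw [e1, e2, h0]; simp
  set X : ℕ → ℂ := fun i => S i
  -- Obtained by solving the first eigenvector equation l X_i = b Y_{i+1} + a X_{i+1} for Y. The
  -- second one then reduces to the characteristic equation `hl` of the symbol.
  set Y : ℕ → ℂ := fun i => (l * S (i - 1) - a * S i) / b
  refine ⟨interleave X Y m, ?_, ?_⟩
  · intro h
    -- The last entry X (m - 1) equals sin θ, which is nonzero.
    have := congrFun h (⟨m - 1, by omega⟩, 0)
    simp only [interleave, X, hS, if_true, Pi.zero_apply, Int.cast_natCast, Nat.cast_sub hm] at this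
    apply hθ
    simpa using this
  · rw [blockToeplitz_mulVec_interleave a b hX (by simpa [Y] using hY)]
    ext ⟨i, r⟩
    have h := hrec i
    fin_cases r
    · simp only [interleave, X, Y, Pi.smul_apply, smul_eq_mul]
      simp
      field_simp
      ring
    · simp only [interleave, X, Y, Pi.smul_apply, smul_eq_mul]
      simp
      field_simp
      linear_combination (-S i) * hl + a * l * h


/-! ### Eigenvalues converging to a + b and a - b -/

theorem isInvertible_of_apply_one_ne_zero {L : ℂ →L[ℂ] ℂ} (h : L 1 ≠ 0) : L.IsInvertible := by
  refine ⟨ContinuousLinearEquiv.unitsEquivAut ℂ (Units.mk0 _ h), ?_⟩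
  ext
  simp

/-- A branch of the eigenvalue of the symbol at `exp (i θ)`. -/
def symbolBranch (a c θ : ℂ) : ℂ :=
  a * Complex.cos θ + c * (1 - (a / c * Complex.sin θ) ^ 2) ^ (1 / 2 : ℂ)

/-- Near θ = 0 the radicand is close to 1, away from the branch cut of the root. -/
theorem analyticAt_symbolBranch (a c : ℂ) : AnalyticAt ℂ (symbolBranch a c) 0 := by
  have h1 : AnalyticAt ℂ Complex.cos 0 := Complex.analyticAt_cos
  have h2 : AnalyticAt ℂ Complex.sin 0 := Complex.analyticAt_sin
  have h3 : AnalyticAt ℂ (fun θ => 1 - (a / c * Complex.sin θ) ^ 2) 0 := by fun_prop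
  have h4 : AnalyticAt ℂ (fun θ => (1 - (a / c * Complex.sin θ) ^ 2) ^ (1 / 2 : ℂ)) 0 :=
    h3.cpow analyticAt_const (by simp)
  unfold symbolBranch
  fun_prop

theorem symbolBranch_zero (a c : ℂ) : symbolBranch a c 0 = a + c := by simp [symbolBranch]

/-- Completing the square turns the characteristic equation into (λ - a cos θ)² = c² - a² sin² θ. -/
theorem symbolBranch_eq {a c θ : ℂ} (hc : c ≠ 0) :
    symbolBranch a c θ ^ 2 + a ^ 2 - c ^ 2 = 2 * a * symbolBranch a c θ * Complex.cos θ := by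
  have h : ((1 - (a / c * Complex.sin θ) ^ 2) ^ (1 / 2 : ℂ)) ^ 2 =
      1 - (a / c * Complex.sin θ) ^ 2 := by
    rw [one_div]
    exact Complex.cpow_ofNat_inv_pow _ 2
  have h2 : c ^ 2 * (a / c * Complex.sin θ) ^ 2 = a ^ 2 * Complex.sin θ ^ 2 := by
    field_simp
  unfold symbolBranch
  linear_combination c ^ 2 * h - h2 + a ^ 2 * (-(Complex.sin_sq_add_cos_sq θ))

/-- There are eigenvalues that tend to `a + c`, where `c = ± b`. -/
theorem exists_tendsto_mem_spectrum {a b c : ℂ} (hb : b ≠ 0) (hc : c ^ 2 = b ^ 2) :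
    ∃ l : ℕ → ℂ, Tendsto l atTop (𝓝 (a + c)) ∧
      ∀ᶠ m in atTop, l m ∈ spectrum ℂ (blockToeplitz a b m) := by
  have hc0 : c ≠ 0 := by
    rintro rfl
    apply hb
    simpa using hc.symm
  -- With ε = 1/(m + 1) and φ = (m + 1)θ, the boundary condition of `mem_spectrum_blockToeplitz`
  -- reads G(ε, φ) = 0, and ε may be treated as a continuous variable.
  let G : ℂ × ℂ → ℂ := fun p =>
    symbolBranch a c (p.1 * p.2) * Complex.sin p.2 - a * Complex.sin ((1 - p.1) * p.2)
  have hfst : AnalyticAt ℂ (Prod.fst : ℂ × ℂ → ℂ) (0, (Real.pi : ℂ)) := analyticAt_fst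
  have hsnd : AnalyticAt ℂ (Prod.snd : ℂ × ℂ → ℂ) (0, (Real.pi : ℂ)) := analyticAt_snd
  have hGa : AnalyticAt ℂ G (0, (Real.pi : ℂ)) := by
    have h1 : AnalyticAt ℂ (fun p : ℂ × ℂ => symbolBranch a c (p.1 * p.2)) (0, (Real.pi : ℂ)) := by
      refine AnalyticAt.fun_comp (g := symbolBranch a c) ?_ (hfst.mul hsnd)
      simpa using analyticAt_symbolBranch a c
    have h2 : AnalyticAt ℂ (fun p : ℂ × ℂ => Complex.sin p.2) (0, (Real.pi : ℂ)) :=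
      AnalyticAt.fun_comp (g := Complex.sin) Complex.analyticAt_sin hsnd
    have h3 : AnalyticAt ℂ (fun p : ℂ × ℂ => Complex.sin ((1 - p.1) * p.2)) (0, (Real.pi : ℂ)) :=
      AnalyticAt.fun_comp (g := Complex.sin) Complex.analyticAt_sin ((analyticAt_const.sub hfst).mul hsnd)
    exact (h1.mul h2).sub (analyticAt_const.mul h3)
  have hG := hGa.hasStrictFDerivAt
  -- At ε = 0 the function is c sin φ, which has a simple zero at φ = π with derivative -c.
  have hinv : (fderiv ℂ G (0, (Real.pi : ℂ)) ∘L .inr ℂ ℂ ℂ).IsInvertible := by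
    apply isInvertible_of_apply_one_ne_zero
    have h1 : HasFDerivAt (fun φ : ℂ => G (0, φ))
        (fderiv ℂ G (0, (Real.pi : ℂ)) ∘L .inr ℂ ℂ ℂ) (Real.pi : ℂ) :=
      HasFDerivAt.comp (f := fun φ : ℂ => ((0 : ℂ), φ)) (Real.pi : ℂ) hG.hasFDerivAt
        (hasFDerivAt_prodMk_right (0 : ℂ) (Real.pi : ℂ))
    have h2 : (fun φ : ℂ => G (0, φ)) = fun φ => c * Complex.sin φ := by
      ext φ
      simp only [G, zero_mul, symbolBranch_zero, sub_zero, one_mul]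
      ring
    rw [h2] at h1
    have h3 := h1.hasDerivAt.unique ((Complex.hasDerivAt_sin (Real.pi : ℂ)).const_mul c)
    rw [h3]
    simpa using hc0
  have hG0 : G (0, (Real.pi : ℂ)) = 0 := by simp [G]
  have hψ := hG.tendsto_implicitFunctionOfProdDomain hinv
  have hψG := hG.eventually_apply_implicitFunctionOfProdDomain hinv
  set ψ := hG.implicitFunctionOfProdDomain hinv
  rw [hG0] at hψG
  simp only at hψ hψG
  have hε : Tendsto (fun m : ℕ => 1 / ((m : ℂ) + 1)) atTop (𝓝 0) :=
    tendsto_one_div_add_atTop_nhds_zero_nat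
  have hψm := hψ.comp hε
  have hθ : Tendsto (fun m : ℕ => 1 / ((m : ℂ) + 1) * ψ (1 / ((m : ℂ) + 1))) atTop (𝓝 0) := by
    simpa using hε.mul hψm
  refine ⟨fun m => symbolBranch a c (1 / ((m : ℂ) + 1) * ψ (1 / ((m : ℂ) + 1))), ?_, ?_⟩
  · rw [← symbolBranch_zero a c]
    exact (analyticAt_symbolBranch a c).continuousAt.tendsto.comp hθ
  -- Since φ tends to π, θ = φ/(m + 1) is small but nonzero, so sin θ ≠ 0.
  · have hsin : ∀ᶠ z in 𝓝[≠] (0 : ℂ), Complex.sin z ≠ 0 :=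
      (Complex.hasDerivAt_sin 0).eventually_ne (by simp)
    rw [eventually_nhdsWithin_iff] at hsin
    have hpi : (Real.pi : ℂ) ≠ 0 := by exact_mod_cast Real.pi_ne_zero
    filter_upwards [hθ.eventually hsin, hε.eventually hψG, hψm.eventually_ne hpi,
      eventually_ge_atTop 1] with m h1 h2 h3 h4
    have hm : (m : ℂ) + 1 ≠ 0 := by exact_mod_cast Nat.succ_ne_zero m
    set φ := ψ (1 / ((m : ℂ) + 1)) with hφ
    have h3' : φ ≠ 0 := h3
    refine mem_spectrum_blockToeplitz h4 hb
      (h1 (mul_ne_zero (one_div_ne_zero hm) h3')) ?_ ?_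
    · rw [← hc]
      exact symbolBranch_eq hc0
    · have e1 : ((m : ℂ) + 1) * (1 / ((m : ℂ) + 1) * φ) = φ := by field_simp
      have e2 : (m : ℂ) * (1 / ((m : ℂ) + 1) * φ) = (1 - 1 / ((m : ℂ) + 1)) * φ := by
        field_simp
        ring
      rw [e1, e2]
      exact sub_eq_zero.1 h2

theorem toReal_spectralRadius_blockToeplitz_le (a b : ℂ) (m : ℕ) :
    (spectralRadius ℂ (blockToeplitz a b m)).toReal ≤ max ‖a + b‖ ‖a - b‖ :=
  ENNReal.toReal_le_of_le_ofReal (le_max_of_le_left (norm_nonneg _))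
    (spectralRadius_blockToeplitz_le a b m)

theorem norm_le_toReal_spectralRadius_blockToeplitz {a b l : ℂ} {m : ℕ}
    (h : l ∈ spectrum ℂ (blockToeplitz a b m)) :
    ‖l‖ ≤ (spectralRadius ℂ (blockToeplitz a b m)).toReal := by
  have h1 : (‖l‖₊ : ENNReal) ≤ spectralRadius ℂ (blockToeplitz a b m) :=
    le_iSup₂ (f := fun k (_ : k ∈ spectrum ℂ (blockToeplitz a b m)) => (‖k‖₊ : ENNReal)) l h
  have h2 := ENNReal.toReal_mono
    ((spectralRadius_blockToeplitz_le a b m).trans_lt ENNReal.ofReal_lt_top).ne h1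
  simpa using h2

/-- The limit of the spectral radius of the block Toeplitz matrices. -/
theorem tendsto_spectralRadius_blockToeplitz (a : ℂ) {b : ℂ} (hb : b ≠ 0) :
    Tendsto (fun m => (spectralRadius ℂ (blockToeplitz a b m)).toReal) atTop
      (𝓝 (max ‖a + b‖ ‖a - b‖)) := by
  obtain ⟨l, hl, hls⟩ := exists_tendsto_mem_spectrum (a := a) hb rfl
  obtain ⟨l', hl', hls'⟩ := exists_tendsto_mem_spectrum (a := a) (c := -b) hb (neg_sq b)
  rw [← sub_eq_add_neg] at hl'
  refine tendsto_of_tendsto_of_tendsto_of_le_of_le' (hl.norm.max hl'.norm) tendsto_const_nhds ?_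
    (Eventually.of_forall fun m => toReal_spectralRadius_blockToeplitz_le a b m)
  filter_upwards [hls, hls'] with m h h'
  exact max_le (norm_le_toReal_spectralRadius_blockToeplitz h)
    (norm_le_toReal_spectralRadius_blockToeplitz h')


/-! ### The root `ζ` and the coefficients -/

theorem zeta_sq (k σ kt : ℝ) :
    zeta k σ kt ^ 2 = Complex.I * k * σ + kt ^ 2 - k ^ 2 :=
  Complex.cpow_ofNat_inv_pow _ 2

theorem zeta_arg_re (k σ kt : ℝ) :
    (Complex.I * k * σ + kt ^ 2 - k ^ 2 : ℂ).re = kt ^ 2 - k ^ 2 := by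
  simp [← Complex.ofReal_pow]

theorem zeta_arg_im (k σ kt : ℝ) :
    (Complex.I * k * σ + kt ^ 2 - k ^ 2 : ℂ).im = k * σ := by
  simp [← Complex.ofReal_pow]

theorem zeta_re_pos {k σ : ℝ} (h : 0 < k * σ) (kt : ℝ) : 0 < (zeta k σ kt).re := by
  have him := zeta_arg_im k σ kt
  unfold zeta
  set w : ℂ := Complex.I * k * σ + kt ^ 2 - k ^ 2
  have h1 := Complex.abs_re_lt_norm.2 (him.trans_ne h.ne')
  have h2 := neg_abs_le w.re
  rw [Complex.sqrt_eq_real_add_ite, if_pos (him.symm ▸ h.le)]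
  simpa using by linarith

theorem zeta_im_pos {k σ : ℝ} (h : 0 < k * σ) (kt : ℝ) : 0 < (zeta k σ kt).im := by
  have him := zeta_arg_im k σ kt
  unfold zeta
  set w : ℂ := Complex.I * k * σ + kt ^ 2 - k ^ 2
  have h1 := Complex.abs_re_lt_norm.2 (him.trans_ne h.ne')
  have h2 := le_abs_self w.re
  rw [Complex.sqrt_eq_real_add_ite, if_pos (him.symm ▸ h.le)]
  simpa using by linarith

theorem zeta_ne_zero {k σ : ℝ} (h : 0 < k * σ) (kt : ℝ) : zeta k σ kt ≠ 0 := fun h0 => by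
  have := zeta_re_pos h kt
  simp [h0] at this

/-- The squares agree, and positivity of both real parts excludes the opposite sign. -/
theorem zeta_scale {k σ : ℝ} (hk : 0 < k) (hσ : 0 < σ) (kt : ℝ) :
    zeta k (σ * k) kt = k * zeta 1 σ (kt / k) := by
  have hk' : (k : ℂ) ≠ 0 := by exact_mod_cast hk.ne'
  have h : zeta k (σ * k) kt ^ 2 = (k * zeta 1 σ (kt / k)) ^ 2 := by
    rw [mul_pow, zeta_sq, zeta_sq]
    push_cast
    field_simp
  refine (sq_eq_sq_iff_eq_or_eq_neg.1 h).resolve_right fun h => ?_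
  have h1 := zeta_re_pos (σ := σ * k) (mul_pos hk (mul_pos hσ hk)) kt
  have h2 := mul_pos hk (zeta_re_pos (k := 1) (σ := σ) (by simpa using hσ) (kt / k))
  rw [h] at h1
  simp only [Complex.neg_re, Complex.re_ofReal_mul] at h1
  linarith

theorem continuous_zeta {k σ : ℝ} (h : k * σ ≠ 0) : Continuous (zeta k σ) := by
  rw [continuous_iff_continuousAt]
  intro kt
  refine ContinuousAt.comp (g := Complex.sqrt)
    (f := fun kt : ℝ => (Complex.I * k * σ + kt ^ 2 - k ^ 2 : ℂ)) ?_ (by fun_prop)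
  exact Complex.continuousAt_sqrt (Or.inr ((zeta_arg_im k σ kt).trans_ne h))

/-- The exponents are scale invariant, while numerator and denominator are both homogeneous of
degree 2 in k. -/
theorem coeffA_scale {k σ : ℝ} (hk : 0 < k) (hσ : 0 < σ) (L δ kt : ℝ) :
    coeffA k (σ * k) (L / k) (δ / k) kt = coeffA 1 σ L δ (kt / k) := by
  have hk' : (k : ℂ) ≠ 0 := by exact_mod_cast hk.ne'
  unfold coeffA coeffDen
  rw [zeta_scale hk hσ]
  set z := zeta 1 σ (kt / k)
  push_cast
  rw [show (k : ℂ) * z * (2 * (δ / k) + L / k) = z * (2 * δ + L) by field_simp,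
    show 2 * ((k : ℂ) * z) * (δ / k) = 2 * z * δ by field_simp]
  conv_rhs => rw [← mul_div_mul_left _ _ (pow_ne_zero 2 hk')]
  congr 1 <;> ring

theorem coeffB_scale {k σ : ℝ} (hk : 0 < k) (hσ : 0 < σ) (L δ kt : ℝ) :
    coeffB k (σ * k) (L / k) (δ / k) kt = coeffB 1 σ L δ (kt / k) := by
  have hk' : (k : ℂ) ≠ 0 := by exact_mod_cast hk.ne'
  unfold coeffB coeffDen
  rw [zeta_scale hk hσ]
  set z := zeta 1 σ (kt / k)
  push_cast
  rw [show (k : ℂ) * z * (2 * (δ / k) + L / k) = z * (2 * δ + L) by field_simp,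
    show (k : ℂ) * z * (L / k) = z * L by field_simp]
  conv_rhs => rw [← mul_div_mul_left _ _ (pow_ne_zero 2 hk')]
  congr 1 <;> ring

theorem iterRadius_scale {k σ : ℝ} (hk : 0 < k) (hσ : 0 < σ) (L δ kt : ℝ) (N : ℕ) :
    iterRadius k (σ * k) (L / k) (δ / k) kt N = iterRadius 1 σ L δ (kt / k) N := by
  unfold iterRadius iterMatrix
  rw [coeffA_scale hk hσ, coeffB_scale hk hσ]

theorem factor1d_scale {k σ : ℝ} (hk : 0 < k) (hσ : 0 < σ) (L δ kt : ℝ) :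
    factor1d k (σ * k) (L / k) (δ / k) kt = factor1d 1 σ L δ (kt / k) := by
  unfold factor1d
  simp only [iterRadius_scale hk hσ]

/-! ### Factorisation of D and of a ± b into traces of centred waves -/

/-- The symmetric (`s = 1`) and antisymmetric (`s = -1`) local solutions, seen by the impedance
operator. -/
def robinWave (k : ℝ) (z s : ℂ) (x : ℝ) : ℂ :=
  (z + Complex.I * k) * Complex.exp (z * x) + s * ((z - Complex.I * k) * Complex.exp (-(z * x)))

theorem norm_sub_I_mul_lt {k : ℝ} {z : ℂ} (hk : 0 < k) (hz : 0 < z.im) :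
    ‖z - Complex.I * k‖ < ‖z + Complex.I * k‖ := by
  rw [← sq_lt_sq₀ (norm_nonneg _) (norm_nonneg _), Complex.sq_norm, Complex.sq_norm,
    Complex.normSq_apply, Complex.normSq_apply]
  simp
  nlinarith [mul_pos hk hz]

/-- For Im z > 0 the growing exponential carries the larger coefficient, so the reverse triangle
inequality keeps the trace away from zero for x > 0. This is what makes the local problems solvable.
-/
theorem le_norm_robinWave {k : ℝ} {z s : ℂ} (hk : 0 < k) (hz : 0 < z.im) (hs : ‖s‖ = 1) (x : ℝ) :
    ‖z + Complex.I * k‖ * (Real.exp (z.re * x) - Real.exp (-(z.re * x))) ≤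
      ‖robinWave k z s x‖ := by
  have h1 := norm_sub_le_norm_add ((z + Complex.I * k) * Complex.exp (z * x))
    (s * ((z - Complex.I * k) * Complex.exp (-(z * x))))
  simp only [norm_mul, hs, Complex.norm_exp] at h1
  have h2 := mul_le_mul_of_nonneg_right (norm_sub_I_mul_lt hk hz).le
    (Real.exp_pos (-(z.re * x))).le
  have e1 : (z * x).re = z.re * x := by simp
  have e2 : (-(z * x)).re = -(z.re * x) := by simp
  rw [e1, e2] at h1
  unfold robinWave
  linarith

theorem norm_robinWave_le {k : ℝ} {z s : ℂ} (hk : 0 < k) (hz : 0 < z.im) (hre : 0 < z.re)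
    (hs : ‖s‖ = 1) (x : ℝ) :
    ‖robinWave k z s x‖ ≤ ‖z + Complex.I * k‖ * (2 * Real.exp (z.re * |x|)) := by
  have h1 := norm_add_le ((z + Complex.I * k) * Complex.exp (z * x))
    (s * ((z - Complex.I * k) * Complex.exp (-(z * x))))
  simp only [norm_mul, hs, Complex.norm_exp] at h1
  have h2 := mul_le_mul_of_nonneg_right (norm_sub_I_mul_lt hk hz).le
    (Real.exp_pos (-(z.re * x))).le
  have e1 : (z * x).re = z.re * x := by simp
  have e2 : (-(z * x)).re = -(z.re * x) := by simp
  rw [e1, e2] at h1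
  have h3 : Real.exp (z.re * x) ≤ Real.exp (z.re * |x|) :=
    Real.exp_le_exp.2 (mul_le_mul_of_nonneg_left (le_abs_self x) hre.le)
  have h4 : Real.exp (-(z.re * x)) ≤ Real.exp (z.re * |x|) := by
    refine Real.exp_le_exp.2 ?_
    rw [← mul_neg]
    exact mul_le_mul_of_nonneg_left (neg_le_abs x) hre.le
  have h5 := mul_le_mul_of_nonneg_left (add_le_add h3 h4) (norm_nonneg (z + Complex.I * k))
  unfold robinWave
  linarith

theorem robinWave_ne_zero {k : ℝ} {z s : ℂ} (hk : 0 < k) (hz : 0 < z.im) (hre : 0 < z.re)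
    (hs : ‖s‖ = 1) {x : ℝ} (hx : 0 < x) : robinWave k z s x ≠ 0 := by
  rw [← norm_pos_iff]
  refine lt_of_lt_of_le (mul_pos ?_ ?_) (le_norm_robinWave hk hz hs x)
  · exact (norm_nonneg _).trans_lt (norm_sub_I_mul_lt hk hz)
  · rw [sub_pos, Real.exp_lt_exp]
    have := mul_pos hre hx
    linarith

section factorization

variable (z : ℂ) (L δ : ℝ)

theorem exp_mul_half_sub :
    Complex.exp (z * ((δ - L / 2 : ℝ) : ℂ)) =
      Complex.exp (z * δ) * Complex.exp (-(z * (L / 2))) := by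
  rw [← Complex.exp_add]; push_cast; ring_nf

theorem exp_mul_half_add :
    Complex.exp (z * ((δ + L / 2 : ℝ) : ℂ)) =
      Complex.exp (z * δ) * Complex.exp (z * (L / 2)) := by
  rw [← Complex.exp_add]; push_cast; ring_nf

theorem exp_neg_mul_half_sub :
    Complex.exp (-(z * ((δ - L / 2 : ℝ) : ℂ))) =
      Complex.exp (-(z * δ)) * Complex.exp (z * (L / 2)) := by
  rw [← Complex.exp_add]; push_cast; ring_nf

theorem exp_neg_mul_half_add :
    Complex.exp (-(z * ((δ + L / 2 : ℝ) : ℂ))) =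
      Complex.exp (-(z * δ)) * Complex.exp (-(z * (L / 2))) := by
  rw [← Complex.exp_add]; push_cast; ring_nf

theorem exp_two_mul_mul : Complex.exp (2 * z * δ) = Complex.exp (z * δ) ^ 2 := by
  rw [← Complex.exp_nat_mul]; push_cast; ring_nf

theorem exp_neg_two_mul_mul : Complex.exp (-(2 * z * δ)) = Complex.exp (-(z * δ)) ^ 2 := by
  rw [← Complex.exp_nat_mul]; push_cast; ring_nf

theorem exp_mul_eq_half_sq : Complex.exp (z * L) = Complex.exp (z * (L / 2)) ^ 2 := by
  rw [← Complex.exp_nat_mul]; push_cast; ring_nf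

theorem exp_neg_mul_eq_half_sq : Complex.exp (-(z * L)) = Complex.exp (-(z * (L / 2))) ^ 2 := by
  rw [← Complex.exp_nat_mul]; push_cast; ring_nf

theorem exp_mul_length :
    Complex.exp (z * (2 * δ + L)) = (Complex.exp (z * δ) * Complex.exp (z * (L / 2))) ^ 2 := by
  rw [← Complex.exp_add, ← Complex.exp_nat_mul]; push_cast; ring_nf

theorem exp_neg_mul_length :
    Complex.exp (-(z * (2 * δ + L))) =
      (Complex.exp (-(z * δ)) * Complex.exp (-(z * (L / 2)))) ^ 2 := by
  rw [← Complex.exp_add, ← Complex.exp_nat_mul]; push_cast; ring_nf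

end factorization

/-- A difference of two squares. -/
theorem coeffDen_eq (k σ L δ kt : ℝ) :
    coeffDen k σ L δ kt = robinWave k (zeta k σ kt) (-1) (δ + L / 2) *
      robinWave k (zeta k σ kt) 1 (δ + L / 2) := by
  unfold coeffDen robinWave
  rw [exp_mul_half_add, exp_neg_mul_half_add, exp_mul_length, exp_neg_mul_length]
  ring

theorem coeffDen_ne_zero {k σ L δ : ℝ} (hk : 0 < k) (hσ : 0 < σ) (hL : 0 < L) (hδ : 0 < δ)
    (kt : ℝ) : coeffDen k σ L δ kt ≠ 0 := by
  rw [coeffDen_eq]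
  have h := mul_pos hk hσ
  exact mul_ne_zero
    (robinWave_ne_zero hk (zeta_im_pos h kt) (zeta_re_pos h kt) (by simp) (by positivity))
    (robinWave_ne_zero hk (zeta_im_pos h kt) (zeta_re_pos h kt) (by simp) (by positivity))

/-- `robinWave` with s = -1 is the right impedance trace of 2 cosh(zx). Even waves receive equal
data at both ends, so the factor from entering to leaving data is a + b; leaving data is read at
distance L from the far end, at δ - L/2 from the midpoint. -/
theorem coeffA_add_coeffB {k σ L δ : ℝ} (hk : 0 < k) (hσ : 0 < σ) (hL : 0 < L) (hδ : 0 < δ)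
    (kt : ℝ) : coeffA k σ L δ kt + coeffB k σ L δ kt =
      robinWave k (zeta k σ kt) (-1) (δ - L / 2) / robinWave k (zeta k σ kt) (-1) (δ + L / 2) := by
  have hD := coeffDen_ne_zero hk hσ hL hδ kt
  have hD' := hD
  rw [coeffDen_eq] at hD'
  have hF := left_ne_zero_of_mul hD'
  unfold coeffA coeffB
  rw [← add_div, div_eq_div_iff hD hF, coeffDen_eq, mul_comm (robinWave k _ (-1) (δ + L / 2)),
    ← mul_assoc]
  congr 1
  unfold robinWave
  rw [exp_mul_half_add, exp_neg_mul_half_add, exp_mul_half_sub, exp_neg_mul_half_sub,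
    exp_two_mul_mul, exp_neg_two_mul_mul, exp_mul_eq_half_sq _ L, exp_neg_mul_eq_half_sq _ L]
  set z := zeta k σ kt
  have h1 : Complex.exp (z * δ) * Complex.exp (-(z * δ)) = 1 := by
    rw [← Complex.exp_add]; simp
  have h2 : Complex.exp (z * (L / 2)) * Complex.exp (-(z * (L / 2))) = 1 := by
    rw [← Complex.exp_add]; simp
  set e := Complex.exp (z * δ)
  set e' := Complex.exp (-(z * δ))
  set f := Complex.exp (z * (L / 2))
  set f' := Complex.exp (-(z * (L / 2)))
  set p := z + Complex.I * k with hp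
  set q := z - Complex.I * k with hq
  rw [show z ^ 2 - (Complex.I * k) ^ 2 = p * q by rw [hp, hq]; ring]
  linear_combination (-(p ^ 2 * e ^ 2 - q ^ 2 * e' ^ 2)) * h2 + p * q * (f ^ 2 - f' ^ 2) * h1

/-- The odd counterpart: s = 1 gives the trace of 2 sinh(zx), whose entering data have opposite
signs at the two ends. -/
theorem coeffA_sub_coeffB {k σ L δ : ℝ} (hk : 0 < k) (hσ : 0 < σ) (hL : 0 < L) (hδ : 0 < δ)
    (kt : ℝ) : coeffA k σ L δ kt - coeffB k σ L δ kt =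
      robinWave k (zeta k σ kt) 1 (δ - L / 2) / robinWave k (zeta k σ kt) 1 (δ + L / 2) := by
  have hD := coeffDen_ne_zero hk hσ hL hδ kt
  have hD' := hD
  rw [coeffDen_eq] at hD'
  have hF := right_ne_zero_of_mul hD'
  unfold coeffA coeffB
  rw [← sub_div, div_eq_div_iff hD hF, coeffDen_eq, ← mul_assoc]
  congr 1
  unfold robinWave
  rw [exp_mul_half_add, exp_neg_mul_half_add, exp_mul_half_sub, exp_neg_mul_half_sub,
    exp_two_mul_mul, exp_neg_two_mul_mul, exp_mul_eq_half_sq _ L, exp_neg_mul_eq_half_sq _ L]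
  set z := zeta k σ kt
  have h1 : Complex.exp (z * δ) * Complex.exp (-(z * δ)) = 1 := by
    rw [← Complex.exp_add]; simp
  have h2 : Complex.exp (z * (L / 2)) * Complex.exp (-(z * (L / 2))) = 1 := by
    rw [← Complex.exp_add]; simp
  set e := Complex.exp (z * δ)
  set e' := Complex.exp (-(z * δ))
  set f := Complex.exp (z * (L / 2))
  set f' := Complex.exp (-(z * (L / 2)))
  set p := z + Complex.I * k with hp
  set q := z - Complex.I * k with hq
  rw [show z ^ 2 - (Complex.I * k) ^ 2 = p * q by rw [hp, hq]; ring]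
  linear_combination (-(p ^ 2 * e ^ 2 - q ^ 2 * e' ^ 2)) * h2 - p * q * (f ^ 2 - f' ^ 2) * h1

/-- ζ² + k² has imaginary part kσ ≠ 0, and the two exponentials differ in modulus because Re ζ > 0.
Nonvanishing of b is required by the spectral limit. -/
theorem coeffB_ne_zero {k σ L δ : ℝ} (hk : 0 < k) (hσ : 0 < σ) (hL : 0 < L) (hδ : 0 < δ)
    (kt : ℝ) : coeffB k σ L δ kt ≠ 0 := by
  have h := mul_pos hk hσ
  refine div_ne_zero (neg_ne_zero.2 (mul_ne_zero ?_ ?_)) (coeffDen_ne_zero hk hσ hL hδ kt)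
  · intro h0
    rw [zeta_sq] at h0
    have := congrArg Complex.im h0
    simp [← Complex.ofReal_pow, mul_pow, hk.ne', hσ.ne'] at this
  · rw [sub_ne_zero]
    intro h0
    have := congrArg (‖·‖) h0
    simp only [Complex.norm_exp, Real.exp_eq_exp] at this
    have h1 := mul_pos (zeta_re_pos h kt) hL
    simp at this
    linarith

theorem continuous_coeffA {k σ L δ : ℝ} (hk : 0 < k) (hσ : 0 < σ) (hL : 0 < L) (hδ : 0 < δ) :
    Continuous (coeffA k σ L δ) := by
  have hz := continuous_zeta (mul_pos hk hσ).ne'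
  have hD : Continuous (coeffDen k σ L δ) := by unfold coeffDen; fun_prop
  exact Continuous.div (by fun_prop) hD (coeffDen_ne_zero hk hσ hL hδ)

theorem continuous_coeffB {k σ L δ : ℝ} (hk : 0 < k) (hσ : 0 < σ) (hL : 0 < L) (hδ : 0 < δ) :
    Continuous (coeffB k σ L δ) := by
  have hz := continuous_zeta (mul_pos hk hσ).ne'
  have hD : Continuous (coeffDen k σ L δ) := by unfold coeffDen; fun_prop
  exact Continuous.div (by fun_prop) hD (coeffDen_ne_zero hk hσ hL hδ)

/-- The limiting spectral radius in closed form. -/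
def modeRate (k σ L δ kt : ℝ) : ℝ :=
  max ‖coeffA k σ L δ kt + coeffB k σ L δ kt‖ ‖coeffA k σ L δ kt - coeffB k σ L δ kt‖

theorem iterRadius_le_modeRate (k σ L δ kt : ℝ) (N : ℕ) :
    iterRadius k σ L δ kt N ≤ modeRate k σ L δ kt :=
  toReal_spectralRadius_blockToeplitz_le _ _ _

theorem tendsto_iterRadius {k σ L δ : ℝ} (hk : 0 < k) (hσ : 0 < σ) (hL : 0 < L) (hδ : 0 < δ)
    (kt : ℝ) : Tendsto (iterRadius k σ L δ kt) atTop (𝓝 (modeRate k σ L δ kt)) :=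
  (tendsto_spectralRadius_blockToeplitz _ (coeffB_ne_zero hk hσ hL hδ kt)).comp
    (tendsto_sub_atTop_nat 1)

theorem factor1d_eq {k σ L δ : ℝ} (hk : 0 < k) (hσ : 0 < σ) (hL : 0 < L) (hδ : 0 < δ)
    (kt : ℝ) : factor1d k σ L δ kt = modeRate k σ L δ kt :=
  (tendsto_iterRadius hk hσ hL hδ kt).limUnder_eq

theorem continuous_modeRate {k σ L δ : ℝ} (hk : 0 < k) (hσ : 0 < σ) (hL : 0 < L) (hδ : 0 < δ) :
    Continuous (modeRate k σ L δ) := by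
  have h1 := continuous_coeffA hk hσ hL hδ
  have h2 := continuous_coeffB hk hσ hL hδ
  exact (h1.add h2).norm.max (h1.sub h2).norm


/-! ### Size of the limiting spectral radius -/

/-- The two moduli contribute weights ξ² + (η ± 1)², whence the cosh and sinh terms; in the cross
term the real exponentials cancel and only the phase survives. -/
theorem sq_norm_robinWave (z : ℂ) {s : ℝ} (hs : s ^ 2 = 1) (x : ℝ) :
    ‖robinWave 1 z s x‖ ^ 2 =
      2 * ((z.re ^ 2 + z.im ^ 2 + 1) * Real.cosh (2 * (z.re * x)) +
        2 * z.im * Real.sinh (2 * (z.re * x)) +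
        s * ((z.re ^ 2 + z.im ^ 2 - 1) * Real.cos (2 * (z.im * x)) -
          2 * z.re * Real.sin (2 * (z.im * x)))) := by
  have e1 : (Complex.exp (z * x)).re = Real.exp (z.re * x) * Real.cos (z.im * x) := by
    simp [Complex.exp_re]
  have e2 : (Complex.exp (z * x)).im = Real.exp (z.re * x) * Real.sin (z.im * x) := by
    simp [Complex.exp_im]
  have e3 : (Complex.exp (-(z * x))).re = Real.exp (-(z.re * x)) * Real.cos (z.im * x) := by
    simp [Complex.exp_re]
  have e4 : (Complex.exp (-(z * x))).im = -(Real.exp (-(z.re * x)) * Real.sin (z.im * x)) := by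
    simp [Complex.exp_im]
  rw [Complex.sq_norm, Complex.normSq_apply, Real.cosh_two_mul, Real.sinh_two_mul,
    Real.cos_two_mul', Real.sin_two_mul]
  unfold robinWave
  simp only [Complex.add_re, Complex.add_im, Complex.mul_re, Complex.mul_im, e1, e2, e3, e4,
    Complex.sub_re, Complex.sub_im, Complex.ofReal_re, Complex.ofReal_im, Complex.I_re,
    Complex.I_im]
  have hE : Real.exp (z.re * x) * Real.exp (-(z.re * x)) = 1 := by
    rw [← Real.exp_add]; simp
  have hC := Real.sin_sq_add_cos_sq (z.im * x)
  rw [Real.cosh_eq, Real.sinh_eq]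
  set E := Real.exp (z.re * x)
  set E' := Real.exp (-(z.re * x))
  set C := Real.cos (z.im * x)
  set S := Real.sin (z.im * x)
  set ξ := z.re
  set η := z.im
  linear_combination
    (E ^ 2 * (ξ ^ 2 + (η + 1) ^ 2) + s ^ 2 * E' ^ 2 * (ξ ^ 2 + (η - 1) ^ 2)) * hC +
    E' ^ 2 * (ξ ^ 2 + (η - 1) ^ 2) * hs +
    2 * s * ((ξ ^ 2 + η ^ 2 - 1) * (C ^ 2 - S ^ 2) - 4 * ξ * S * C) * hE

/-- The damping of one local solve dominates the oscillation. -/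
def DampingDominates (ξ η L δ : ℝ) : Prop :=
  |Real.sin (η * L) * ((ξ ^ 2 + η ^ 2 - 1) * Real.sin (2 * (η * δ)) +
      2 * ξ * Real.cos (2 * (η * δ)))| <
    Real.sinh (ξ * L) * ((ξ ^ 2 + η ^ 2 + 1) * Real.sinh (2 * (ξ * δ)) +
      2 * η * Real.cosh (2 * (ξ * δ)))

/-- By the addition formulas, the difference of the squared moduli is 4 times the right side of
`DampingDominates` minus s times the quantity inside its absolute value. The absolute value thus
covers both signs of s. -/
theorem norm_robinWave_lt {z : ℂ} {L δ s : ℝ} (hs : s ^ 2 = 1)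
    (h : DampingDominates z.re z.im L δ) :
    ‖robinWave 1 z s (δ - L / 2)‖ < ‖robinWave 1 z s (δ + L / 2)‖ := by
  rw [← sq_lt_sq₀ (norm_nonneg _) (norm_nonneg _), sq_norm_robinWave z hs,
    sq_norm_robinWave z hs]
  unfold DampingDominates at h
  rw [show 2 * (z.re * (δ - L / 2)) = 2 * (z.re * δ) - z.re * L by ring,
    show 2 * (z.im * (δ - L / 2)) = 2 * (z.im * δ) - z.im * L by ring,
    show 2 * (z.re * (δ + L / 2)) = 2 * (z.re * δ) + z.re * L by ring,
    show 2 * (z.im * (δ + L / 2)) = 2 * (z.im * δ) + z.im * L by ring,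
    Real.cosh_add, Real.cosh_sub, Real.sinh_add, Real.sinh_sub, Real.cos_add, Real.cos_sub,
    Real.sin_add, Real.sin_sub]
  have hB := abs_lt.1 h
  rcases sq_eq_sq_iff_eq_or_eq_neg.1 (hs.trans (one_pow 2).symm) with rfl | rfl
  · linarith [hB.2]
  · linarith [hB.1]

theorem modeRate_lt_one {σ L δ κ : ℝ} (hσ : 0 < σ) (hL : 0 < L) (hδ : 0 < δ)
    (h : DampingDominates (zeta 1 σ κ).re (zeta 1 σ κ).im L δ) : modeRate 1 σ L δ κ < 1 := by
  have hσ' : 0 < 1 * σ := by simpa using hσ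
  have hx : 0 < δ + L / 2 := by positivity
  unfold modeRate
  rw [coeffA_add_coeffB one_pos hσ hL hδ, coeffA_sub_coeffB one_pos hσ hL hδ]
  refine max_lt ?_ ?_
  · have h1 := norm_robinWave_lt (s := -1) (by norm_num) h
    push_cast at h1
    rw [norm_div, div_lt_one ((norm_nonneg _).trans_lt h1)]
    exact h1
  · have h1 := norm_robinWave_lt (s := 1) (by norm_num) h
    push_cast at h1
    rw [norm_div, div_lt_one ((norm_nonneg _).trans_lt h1)]
    exact h1

theorem abs_sin_mul_le {η x : ℝ} (h : 0 ≤ η * x) : |Real.sin (η * x)| ≤ η * x :=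
  (Real.abs_sin_le_abs).trans (abs_of_nonneg h).le

/-- Linearise with |sin x| ≤ x ≤ sinh x and cosh ≥ 1. With Q = ξ² + η², what remains is 2δQ(ξ² + 1 -
η²) ≥ 0. -/
theorem dampingDominates_of_one_le {ξ η L δ : ℝ} (hξ : 0 < ξ) (hη : 0 < η) (hL : 0 < L)
    (hδ : 0 < δ) (h1 : 1 ≤ ξ ^ 2 + η ^ 2) (h2 : η ^ 2 ≤ ξ ^ 2 + 1) :
    DampingDominates ξ η L δ := by
  unfold DampingDominates
  set Q := ξ ^ 2 + η ^ 2 with hQ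
  have hs1 : ξ * L < Real.sinh (ξ * L) := Real.self_lt_sinh_iff.2 (by positivity)
  have hs2 : 2 * (ξ * δ) < Real.sinh (2 * (ξ * δ)) := Real.self_lt_sinh_iff.2 (by positivity)
  have hc := Real.one_le_cosh (2 * (ξ * δ))
  have hsin := abs_sin_mul_le (mul_pos hη hL).le
  have hsin2 : |Real.sin (2 * (η * δ))| ≤ 2 * (η * δ) :=
    Real.abs_sin_le_abs.trans (abs_of_nonneg (by positivity)).le
  have hcos := Real.abs_cos_le_one (2 * (η * δ))
  have hW : |(Q - 1) * Real.sin (2 * (η * δ)) + 2 * ξ * Real.cos (2 * (η * δ))| ≤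
      (Q - 1) * (2 * (η * δ)) + 2 * ξ := by
    refine (abs_add_le _ _).trans ?_
    rw [abs_mul, abs_mul, abs_of_nonneg (sub_nonneg.2 h1), abs_of_pos (by positivity : 0 < 2 * ξ)]
    refine add_le_add (mul_le_mul_of_nonneg_left hsin2 (by linarith)) ?_
    exact mul_le_of_le_one_right (by positivity) hcos
  have hV : (Q + 1) * (2 * (ξ * δ)) + 2 * η ≤
      (Q + 1) * Real.sinh (2 * (ξ * δ)) + 2 * η * Real.cosh (2 * (ξ * δ)) :=
    add_le_add (mul_le_mul_of_nonneg_left hs2.le (by linarith))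
      (le_mul_of_one_le_right (by positivity) hc)
  have hcmp : η * ((Q - 1) * (2 * (η * δ)) + 2 * ξ) ≤ ξ * ((Q + 1) * (2 * (ξ * δ)) + 2 * η) := by
    have : 0 ≤ 2 * δ * (Q * (ξ ^ 2 + 1 - η ^ 2)) :=
      mul_nonneg (by positivity) (mul_nonneg (by linarith) (by linarith))
    rw [hQ] at this ⊢
    nlinarith [this]
  rw [abs_mul]
  calc |Real.sin (η * L)| * |(Q - 1) * Real.sin (2 * (η * δ)) + 2 * ξ * Real.cos (2 * (η * δ))|
      ≤ η * L * ((Q - 1) * (2 * (η * δ)) + 2 * ξ) :=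
        mul_le_mul hsin hW (abs_nonneg _) (by positivity)
    _ = L * (η * ((Q - 1) * (2 * (η * δ)) + 2 * ξ)) := by ring
    _ ≤ L * (ξ * ((Q + 1) * (2 * (ξ * δ)) + 2 * η)) := mul_le_mul_of_nonneg_left hcmp hL.le
    _ = ξ * L * ((Q + 1) * (2 * (ξ * δ)) + 2 * η) := by ring
    _ < Real.sinh (ξ * L) * ((Q + 1) * (2 * (ξ * δ)) + 2 * η) :=
        mul_lt_mul_of_pos_right hs1 (by positivity)
    _ ≤ _ := mul_le_mul_of_nonneg_left hV (Real.sinh_nonneg_iff.2 (by positivity))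

/-- Cauchy–Schwarz bounds the oscillating factor by ξ² + η² + 1 uniformly in δ; the overlap supplies
the large sinh(2ξδ), and the width enters only through |sin(ηL)| ≤ ηL and ξL < sinh(ξL). -/
theorem dampingDominates_of_overlap {ξ η L δ : ℝ} (hξ : 0 < ξ) (hη : 0 < η) (hL : 0 < L)
    (h : η ≤ ξ * Real.sinh (2 * (ξ * δ))) : DampingDominates ξ η L δ := by
  unfold DampingDominates
  have hs1 : ξ * L < Real.sinh (ξ * L) := Real.self_lt_sinh_iff.2 (by positivity)
  have hc := Real.cosh_pos (2 * (ξ * δ))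
  have hsh : 0 < Real.sinh (2 * (ξ * δ)) := pos_of_mul_pos_right (hη.trans_le h) hξ.le
  have hsin := abs_sin_mul_le (mul_pos hη hL).le
  have hW : |(ξ ^ 2 + η ^ 2 - 1) * Real.sin (2 * (η * δ)) + 2 * ξ * Real.cos (2 * (η * δ))| ≤
      ξ ^ 2 + η ^ 2 + 1 := by
    refine abs_le_of_sq_le_sq ?_ (by positivity)
    have hC := Real.sin_sq_add_cos_sq (2 * (η * δ))
    set S := Real.sin (2 * (η * δ))
    set C := Real.cos (2 * (η * δ))
    have h1 : ((ξ ^ 2 + η ^ 2 - 1) * S + 2 * ξ * C) ^ 2 +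
        ((ξ ^ 2 + η ^ 2 - 1) * C - 2 * ξ * S) ^ 2 =
        ((ξ ^ 2 + η ^ 2 - 1) ^ 2 + (2 * ξ) ^ 2) * (S ^ 2 + C ^ 2) := by ring
    rw [hC] at h1
    nlinarith [sq_nonneg ((ξ ^ 2 + η ^ 2 - 1) * C - 2 * ξ * S), sq_nonneg η]
  rw [abs_mul]
  calc |Real.sin (η * L)| * |_|
      ≤ η * L * (ξ ^ 2 + η ^ 2 + 1) := mul_le_mul hsin hW (abs_nonneg _) (by positivity)
    _ = L * (ξ ^ 2 + η ^ 2 + 1) * η := by ring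
    _ ≤ L * (ξ ^ 2 + η ^ 2 + 1) * (ξ * Real.sinh (2 * (ξ * δ))) :=
        mul_le_mul_of_nonneg_left h (by positivity)
    _ = ξ * L * ((ξ ^ 2 + η ^ 2 + 1) * Real.sinh (2 * (ξ * δ))) := by ring
    _ < Real.sinh (ξ * L) * ((ξ ^ 2 + η ^ 2 + 1) * Real.sinh (2 * (ξ * δ))) :=
        mul_lt_mul_of_pos_right hs1 (by positivity)
    _ ≤ _ := mul_le_mul_of_nonneg_left (le_add_of_nonneg_right (by positivity))
        (Real.sinh_nonneg_iff.2 (by positivity))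

/-- Here the large factor is sinh(ξL): sin(ηL) is bounded by 1 and the overlap terms are linearised,
so that δ may be arbitrarily small. -/
theorem dampingDominates_of_width {ξ η L δ : ℝ} (hξ : 0 < ξ) (hη : 0 < η) (hL : 0 < L)
    (hδ : 0 < δ) (h1 : η ≤ ξ * Real.sinh (ξ * L)) (h2 : ξ < η * Real.sinh (ξ * L)) :
    DampingDominates ξ η L δ := by
  unfold DampingDominates
  have hs2 : 2 * (ξ * δ) < Real.sinh (2 * (ξ * δ)) := Real.self_lt_sinh_iff.2 (by positivity)
  have hc := Real.one_le_cosh (2 * (ξ * δ))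
  have hsh : 0 < Real.sinh (ξ * L) := Real.sinh_pos_iff.2 (by positivity)
  have hsin2 : |Real.sin (2 * (η * δ))| ≤ 2 * (η * δ) :=
    Real.abs_sin_le_abs.trans (abs_of_nonneg (by positivity)).le
  have hQ : |ξ ^ 2 + η ^ 2 - 1| ≤ ξ ^ 2 + η ^ 2 + 1 := by
    rw [abs_le]; constructor <;> nlinarith [sq_nonneg ξ, sq_nonneg η]
  have hW : |(ξ ^ 2 + η ^ 2 - 1) * Real.sin (2 * (η * δ)) + 2 * ξ * Real.cos (2 * (η * δ))| ≤
      (ξ ^ 2 + η ^ 2 + 1) * (2 * (η * δ)) + 2 * ξ := by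
    refine (abs_add_le _ _).trans ?_
    rw [abs_mul, abs_mul, abs_of_pos (by positivity : 0 < 2 * ξ)]
    exact add_le_add (mul_le_mul hQ hsin2 (abs_nonneg _) (by positivity))
      (mul_le_of_le_one_right (by positivity) (Real.abs_cos_le_one _))
  rw [abs_mul]
  calc |Real.sin (η * L)| * |_|
      ≤ (ξ ^ 2 + η ^ 2 + 1) * (2 * (η * δ)) + 2 * ξ :=
        (mul_le_of_le_one_left (abs_nonneg _) (Real.abs_sin_le_one _)).trans hW
    _ = (ξ ^ 2 + η ^ 2 + 1) * (2 * δ) * η + 2 * ξ := by ring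
    _ < (ξ ^ 2 + η ^ 2 + 1) * (2 * δ) * (ξ * Real.sinh (ξ * L)) +
          2 * (η * Real.sinh (ξ * L)) :=
        add_lt_add_of_le_of_lt (mul_le_mul_of_nonneg_left h1 (by positivity)) (by linarith)
    _ = Real.sinh (ξ * L) * ((ξ ^ 2 + η ^ 2 + 1) * (2 * (ξ * δ)) + 2 * η * 1) := by ring
    _ ≤ _ := by gcongr

/-! ### Bounds on ζ at k = 1, uniform in the Fourier number -/

theorem zeta_re_mul_im (σ κ : ℝ) : 2 * (zeta 1 σ κ).re * (zeta 1 σ κ).im = σ := by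
  have h := congrArg Complex.im (zeta_sq 1 σ κ)
  rw [zeta_arg_im, sq, Complex.mul_im] at h
  linarith

theorem zeta_re_sq_sub_im_sq (σ κ : ℝ) :
    (zeta 1 σ κ).re ^ 2 - (zeta 1 σ κ).im ^ 2 = κ ^ 2 - 1 := by
  have h := congrArg Complex.re (zeta_sq 1 σ κ)
  rw [zeta_arg_re, sq, Complex.mul_re] at h
  linarith

/-- If ξ < 1, then η² ≤ ξ² + 1 < 2, so σ² = 4ξ²η² ≤ 8ξ², incompatible with ξ < σ/4. -/
theorem min_le_zeta_re {σ : ℝ} (hσ : 0 < σ) (κ : ℝ) : min 1 (σ / 4) ≤ (zeta 1 σ κ).re := by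
  have h1 := zeta_re_mul_im σ κ
  have h2 := zeta_re_sq_sub_im_sq σ κ
  have h3 : 0 < (zeta 1 σ κ).re := zeta_re_pos (by simpa using hσ) κ
  set ξ := (zeta 1 σ κ).re
  set η := (zeta 1 σ κ).im
  by_contra! h
  obtain ⟨ha, hb⟩ := lt_min_iff.1 h
  have h4 : η ^ 2 ≤ ξ ^ 2 + 1 := by nlinarith [sq_nonneg κ]
  have h5 : ξ ^ 2 < 1 := by nlinarith
  have h6 : σ ^ 2 = 4 * (ξ ^ 2 * η ^ 2) := by rw [← h1]; ring
  have h7 : ξ ^ 2 * η ^ 2 ≤ ξ ^ 2 * 2 := mul_le_mul_of_nonneg_left (by linarith) (sq_nonneg _)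
  nlinarith

theorem half_sq_le_sinh {x : ℝ} (hx : 0 ≤ x) : x ^ 2 / 2 ≤ Real.sinh x := by
  have h1 : x / 2 ≤ Real.sinh (x / 2) := Real.self_le_sinh_iff.2 (by positivity)
  have h2 := Real.sinh_lt_cosh (x / 2)
  have h3 : Real.sinh x = 2 * Real.sinh (x / 2) * Real.cosh (x / 2) := by
    rw [← Real.sinh_two_mul]; ring_nf
  nlinarith

/-- A threshold for the width and for the overlap, which depends only on the damping. -/
def robustThreshold (σ : ℝ) : ℝ := 1 + 4 / σ + σ / min 1 (σ / 4) ^ 3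

theorem zeta_im_le_of_threshold {σ κ t x : ℝ} (hσ : 0 < σ) (ht : robustThreshold σ ≤ t)
    (hx : (zeta 1 σ κ).re * t ≤ x) : (zeta 1 σ κ).im ≤ (zeta 1 σ κ).re * x := by
  have hm : 0 < min 1 (σ / 4) := lt_min one_pos (by positivity)
  have h0 := min_le_zeta_re hσ κ
  have h1 := zeta_re_mul_im σ κ
  set ξ := (zeta 1 σ κ).re
  set η := (zeta 1 σ κ).im
  have hξ : 0 < ξ := hm.trans_le h0
  have h2 : σ / min 1 (σ / 4) ^ 3 ≤ t := by
    refine le_trans ?_ ht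
    unfold robustThreshold
    have : 0 < 4 / σ := by positivity
    linarith
  rw [div_le_iff₀ (by positivity)] at h2
  have ht0 : 0 ≤ t := by
    by_contra! h
    have : t * min 1 (σ / 4) ^ 3 < 0 := mul_neg_of_neg_of_pos h (by positivity)
    linarith
  -- The last summand of the threshold is made for this: since η = σ/(2ξ), the goal η ≤ ξ²t asks for
  -- σ ≤ 2tξ³.
  have h3 : σ ≤ t * ξ ^ 3 :=
    h2.trans (mul_le_mul_of_nonneg_left (pow_le_pow_left₀ hm.le h0 3) ht0)
  have h4 : ξ * η ≤ ξ * (ξ * x) := by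
    have : ξ * ξ * (ξ * t) ≤ ξ * ξ * x := mul_le_mul_of_nonneg_left hx (by positivity)
    nlinarith
  exact le_of_mul_le_mul_left h4 hξ

theorem dampingDominates_zeta {σ L δ : ℝ} (hσ : 0 < σ) (hL : 0 < L) (hδ : 0 < δ)
    (h : 1 ≤ σ ∨ robustThreshold σ ≤ L ∨ robustThreshold σ ≤ δ) (κ : ℝ) :
    DampingDominates (zeta 1 σ κ).re (zeta 1 σ κ).im L δ := by
  have hσ' : 0 < 1 * σ := by simpa using hσ
  have hξ := zeta_re_pos hσ' κ
  have hη := zeta_im_pos hσ' κ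
  have h1 := zeta_re_mul_im σ κ
  have h2 := zeta_re_sq_sub_im_sq σ κ
  rcases h with h | h | h
  · refine dampingDominates_of_one_le hξ hη hL hδ ?_ ?_
    · nlinarith [sq_nonneg ((zeta 1 σ κ).re - (zeta 1 σ κ).im)]
    · nlinarith [sq_nonneg κ]
  · refine dampingDominates_of_width hξ hη hL hδ
      (zeta_im_le_of_threshold hσ h (Real.self_le_sinh_iff.2 (by positivity))) ?_
    have h3 := half_sq_le_sinh (mul_pos hξ hL).le
    set ξ := (zeta 1 σ κ).re
    set η := (zeta 1 σ κ).im
    have hm : 0 < min 1 (σ / 4) := lt_min one_pos (by positivity)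
    have hL1 : 1 + 4 / σ ≤ L := by
      refine le_trans ?_ h
      unfold robustThreshold
      have : 0 < σ / min 1 (σ / 4) ^ 3 := by positivity
      linarith
    have hL2 : σ + 4 ≤ L * σ := by
      have := mul_le_mul_of_nonneg_right hL1 hσ.le
      rwa [add_mul, one_mul, div_mul_cancel₀ _ hσ.ne'] at this
    have hL3 : 1 ≤ L := by
      have : 0 < 4 / σ := by positivity
      linarith
    -- This uses the summands 1 + 4/σ of the threshold; with σ = 2ξη and sinh x ≥ x²/2 it gives ξ <
    -- η sinh(ξL).
    have hL4 : 4 < L ^ 2 * σ := by nlinarith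
    calc ξ < ξ * (L ^ 2 * σ / 4) := lt_mul_of_one_lt_right hξ (by linarith)
      _ = η * ((ξ * L) ^ 2 / 2) := by rw [← h1]; ring
      _ ≤ _ := mul_le_mul_of_nonneg_left h3 hη.le
  · refine dampingDominates_of_overlap hξ hη hL
      (zeta_im_le_of_threshold hσ h ?_)
    have := mul_pos hξ hδ
    refine le_trans ?_ (Real.self_le_sinh_iff.2 (by positivity))
    linarith

/-! ### Decay for large Fourier numbers -/

theorem tendsto_zeta_re_atTop {σ : ℝ} (hσ : 0 < σ) :
    Tendsto (fun κ => (zeta 1 σ κ).re) atTop atTop := by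
  refine tendsto_atTop_mono' _ ?_ (tendsto_atTop_add_const_right atTop (-1 : ℝ) tendsto_id)
  filter_upwards [eventually_ge_atTop 1] with κ hκ
  have h2 := zeta_re_sq_sub_im_sq σ κ
  have h3 : 0 < (zeta 1 σ κ).re := zeta_re_pos (by simpa using hσ) κ
  refine le_of_sq_le_sq ?_ h3.le
  simp only [id]
  nlinarith [sq_nonneg (zeta 1 σ κ).im]

/-- The common factor |z + ik| cancels, leaving exponential decay in Re z because |δ - L/2| < δ +
L/2. -/
theorem norm_robinWave_div_le {z s : ℂ} {L δ : ℝ} (hz : 0 < z.im) (hre : 0 < z.re)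
    (hs : ‖s‖ = 1) (hL : 0 < L) (hδ : 0 < δ) :
    ‖robinWave 1 z s (δ - L / 2) / robinWave 1 z s (δ + L / 2)‖ ≤
      2 * Real.exp (-(z.re * (δ + L / 2 - |δ - L / 2|))) /
        (1 - Real.exp (-(z.re * (2 * (δ + L / 2))))) := by
  have hx : 0 < δ + L / 2 := by positivity
  have h1 := norm_robinWave_le one_pos hz hre hs (δ - L / 2)
  have h2 := le_norm_robinWave one_pos hz hs (δ + L / 2)
  have h0 : 0 < ‖z + Complex.I * (1 : ℝ)‖ := (norm_nonneg _).trans_lt (norm_sub_I_mul_lt one_pos hz)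
  have h3 : 0 < Real.exp (z.re * (δ + L / 2)) - Real.exp (-(z.re * (δ + L / 2))) := by
    rw [sub_pos, Real.exp_lt_exp]
    have := mul_pos hre hx
    linarith
  have e1 : Real.exp (z.re * |δ - L / 2|) = Real.exp (z.re * (δ + L / 2)) *
      Real.exp (-(z.re * (δ + L / 2 - |δ - L / 2|))) := by
    rw [← Real.exp_add]; ring_nf
  have e2 : Real.exp (-(z.re * (δ + L / 2))) = Real.exp (z.re * (δ + L / 2)) *
      Real.exp (-(z.re * (2 * (δ + L / 2)))) := by
    rw [← Real.exp_add]; ring_nf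
  rw [norm_div]
  calc _ ≤ ‖z + Complex.I * (1 : ℝ)‖ * (2 * Real.exp (z.re * |δ - L / 2|)) /
        (‖z + Complex.I * (1 : ℝ)‖ *
          (Real.exp (z.re * (δ + L / 2)) - Real.exp (-(z.re * (δ + L / 2))))) :=
        div_le_div₀ (by positivity) h1 (by positivity) h2
    _ = _ := by
      rw [mul_div_mul_left _ _ h0.ne', e1, e2, ← mul_one_sub, mul_left_comm,
        mul_div_mul_left _ _ (Real.exp_ne_zero _)]

theorem tendsto_modeRate_atTop {σ L δ : ℝ} (hσ : 0 < σ) (hL : 0 < L) (hδ : 0 < δ) :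
    Tendsto (modeRate 1 σ L δ) atTop (𝓝 0) := by
  have hσ' : 0 < 1 * σ := by simpa using hσ
  have hx : 0 < δ + L / 2 := by positivity
  have hY : 0 < δ + L / 2 - |δ - L / 2| := by
    rw [sub_pos, abs_lt]; constructor <;> linarith
  have hexp : ∀ c : ℝ, 0 < c →
      Tendsto (fun κ => Real.exp (-((zeta 1 σ κ).re * c))) atTop (𝓝 0) := fun c hc =>
    Real.tendsto_exp_neg_atTop_nhds_zero.comp ((tendsto_zeta_re_atTop hσ).atTop_mul_const hc)
  have hlim := ((hexp _ hY).const_mul 2).div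
    ((hexp _ (by positivity : 0 < 2 * (δ + L / 2))).const_sub 1) (by norm_num)
  rw [mul_zero, zero_div] at hlim
  refine squeeze_zero (fun κ => le_max_of_le_left (norm_nonneg _)) (fun κ => ?_) hlim
  unfold modeRate
  rw [coeffA_add_coeffB one_pos hσ hL hδ, coeffA_sub_coeffB one_pos hσ hL hδ]
  exact max_le
    (norm_robinWave_div_le (zeta_im_pos hσ' κ) (zeta_re_pos hσ' κ) (by simp) hL hδ)
    (norm_robinWave_div_le (zeta_im_pos hσ' κ) (zeta_re_pos hσ' κ) (by simp) hL hδ)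

/-- A continuous function that vanishes at infinity is bounded on `[0, ∞)`, by one of its values
unless it is small. -/
theorem exists_bound_of_tendsto_zero {g : ℝ → ℝ} (hg : Continuous g)
    (h0 : Tendsto g atTop (𝓝 0)) :
    ∃ q, (∀ κ, 0 ≤ κ → g κ ≤ q) ∧ (q = 1 / 2 ∨ ∃ κ, q = g κ) := by
  obtain ⟨K, hK⟩ := eventually_atTop.1 (h0.eventually_le_const (by norm_num : (0 : ℝ) < 1 / 2))
  obtain ⟨κ₀, -, hmax⟩ := isCompact_Icc.exists_isMaxOn
    (Set.nonempty_Icc.2 (le_max_left 0 K)) hg.continuousOn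
  refine ⟨max (1 / 2) (g κ₀), fun κ hκ => ?_, ?_⟩
  · rcases le_total K κ with h | h
    · exact (hK κ h).trans (le_max_left _ _)
    · exact (hmax ⟨hκ, h.trans (le_max_right _ _)⟩).trans (le_max_right _ _)
  · rcases max_choice (1 / 2) (g κ₀) with h | h
    · exact Or.inl h
    · exact Or.inr ⟨κ₀, h⟩


/-! ### The local problems -/

/-- The general solution of `ζ² w = w''`. -/
def expWave (z A B : ℂ) (α : ℝ) (x : ℝ) : ℂ :=
  A * Complex.exp (z * (x - α)) + B * Complex.exp (-(z * (x - α)))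

theorem hasDerivAt_exp_mul_sub (z : ℂ) (α x : ℝ) :
    HasDerivAt (fun x : ℝ => Complex.exp (z * (x - α))) (z * Complex.exp (z * (x - α))) x := by
  have h := ((Complex.ofRealCLM.hasDerivAt (x := x)).sub_const (α : ℂ)).const_mul z |>.cexp
  simpa [mul_comm] using h

theorem hasDerivAt_expWave (z A B : ℂ) (α x : ℝ) :
    HasDerivAt (expWave z A B α) (expWave z (z * A) (-(z * B)) α x) x := by
  have h1 := (hasDerivAt_exp_mul_sub z α x).const_mul A
  have h2 := (hasDerivAt_exp_mul_sub (-z) α x).const_mul B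
  simp only [neg_mul] at h2
  refine (h1.add h2).congr_deriv ?_
  unfold expWave
  ring

theorem deriv_expWave (z A B : ℂ) (α : ℝ) :
    deriv (expWave z A B α) = expWave z (z * A) (-(z * B)) α :=
  funext fun x => (hasDerivAt_expWave z A B α x).deriv

theorem contDiff_expWave (z A B : ℂ) (α : ℝ) {n : WithTop ℕ∞} : ContDiff ℝ n (expWave z A B α) := by
  have h : ContDiff ℝ n (fun x : ℝ => (x : ℂ)) := Complex.ofRealCLM.contDiff
  unfold expWave
  fun_prop

section uniqueness

variable {α β : ℝ} {w : ℝ → ℂ} {z : ℂ}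

theorem hasDerivAt_of_contDiffOn (hw : ContDiffOn ℝ 2 w (Set.Icc α β)) {x : ℝ}
    (hx : x ∈ Set.Ioo α β) : HasDerivAt w (derivWithin w (Set.Icc α β) x) x :=
  ((hw.differentiableOn (by norm_num)) x (Set.Ioo_subset_Icc_self hx)).hasDerivWithinAt.hasDerivAt
    (Icc_mem_nhds hx.1 hx.2)

theorem hasDerivAt_derivWithin (hαβ : α < β) (hw : ContDiffOn ℝ 2 w (Set.Icc α β))
    (hode : ∀ x ∈ Set.Ioo α β, z ^ 2 * w x - deriv (deriv w) x = 0) {x : ℝ}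
    (hx : x ∈ Set.Ioo α β) :
    HasDerivAt (derivWithin w (Set.Icc α β)) (z ^ 2 * w x) x := by
  have h1 : ContDiffOn ℝ 1 (derivWithin w (Set.Icc α β)) (Set.Icc α β) :=
    hw.derivWithin (uniqueDiffOn_Icc hαβ) (by norm_num)
  have h2 := ((h1.differentiableOn (by norm_num)) x
    (Set.Ioo_subset_Icc_self hx)).hasDerivWithinAt.hasDerivAt (Icc_mem_nhds hx.1 hx.2)
  have h3 : derivWithin w (Set.Icc α β) =ᶠ[𝓝 x] deriv w := by
    filter_upwards [Ioo_mem_nhds hx.1 hx.2] with y hy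
    exact (hasDerivAt_of_contDiffOn hw hy).deriv.symm
  have h4 := (h2.congr_of_eventuallyEq h3.symm).deriv
  rw [← h4, ← sub_eq_zero.1 (hode x hx)] at h2
  exact h2

/-- Factor the equation as (∂ + z)(∂ - z)w = 0: multiplied by exp(z(x - α)), w' - zw has zero
derivative inside, and continuity carries the constant to the end points. -/
theorem derivWithin_sub_mul_eq (hαβ : α < β) (hw : ContDiffOn ℝ 2 w (Set.Icc α β))
    (hode : ∀ x ∈ Set.Ioo α β, z ^ 2 * w x - deriv (deriv w) x = 0) :
    ∃ C : ℂ, ∀ x ∈ Set.Icc α β,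
      derivWithin w (Set.Icc α β) x - z * w x = C * Complex.exp (-(z * (x - α))) := by
  set d := derivWithin w (Set.Icc α β) with hd
  set p : ℝ → ℂ := fun x => (d x - z * w x) * Complex.exp (z * (x - α)) with hp
  have hdc : ContinuousOn d (Set.Icc α β) :=
    (hw.derivWithin (uniqueDiffOn_Icc hαβ) (m := 1) (by norm_num)).continuousOn
  have hpc : ContinuousOn p (Set.Icc α β) := by
    have := hw.continuousOn
    exact (hdc.sub (continuousOn_const.mul this)).mul (by fun_prop)
  have hpd : ∀ x ∈ Set.Ioo α β, HasDerivAt p 0 x := by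
    intro x hx
    have h1 := hasDerivAt_of_contDiffOn hw hx
    have h2 := hasDerivAt_derivWithin hαβ hw hode hx
    refine ((h2.sub (h1.const_mul z)).mul (hasDerivAt_exp_mul_sub z α x)).congr_deriv ?_
    simp only [Pi.sub_apply, ← hd]
    ring
  obtain ⟨x₀, hx₀⟩ := Set.nonempty_Ioo.2 hαβ
  have hconst : Set.EqOn p (fun _ => p x₀) (Set.Ioo α β) := fun x hx =>
    isOpen_Ioo.is_const_of_deriv_eq_zero isPreconnected_Ioo
      (fun y hy => (hpd y hy).differentiableAt.differentiableWithinAt)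
      (fun y hy => (hpd y hy).deriv) hx hx₀
  have hall := hconst.of_subset_closure hpc continuousOn_const Set.Ioo_subset_Icc_self
    (closure_Ioo hαβ.ne).ge
  refine ⟨p x₀, fun x hx => ?_⟩
  have hpx : p x = p x₀ := hall hx
  rw [← hpx]
  simp only [hp]
  rw [mul_assoc, ← Complex.exp_add, add_neg_cancel, Complex.exp_zero, mul_one]

/-- Both first-order factorisations, with z and with -z, give two linear equations for w and w';
eliminate w'. -/
theorem exists_eq_expWave (hz : z ≠ 0) (hαβ : α < β) (hw : ContDiffOn ℝ 2 w (Set.Icc α β))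
    (hode : ∀ x ∈ Set.Ioo α β, z ^ 2 * w x - deriv (deriv w) x = 0) :
    ∃ A B : ℂ, Set.EqOn w (expWave z A B α) (Set.Icc α β) := by
  obtain ⟨C, hC⟩ := derivWithin_sub_mul_eq hαβ hw hode
  obtain ⟨C', hC'⟩ := derivWithin_sub_mul_eq (z := -z) hαβ hw (by simpa using hode)
  refine ⟨C' / (2 * z), -C / (2 * z), fun x hx => ?_⟩
  have h1 := hC x hx
  have h2 := hC' x hx
  simp only [neg_mul, neg_neg] at h2
  unfold expWave
  field_simp
  linear_combination h2 - h1

end uniqueness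

/-! ### Impedance traces of the local solutions -/

section traces

variable {a₁ k L δ : ℝ} {w : ℕ → ℝ → ℂ} {j : ℕ} {z A B : ℂ}

theorem leftEnd_lt_rightEnd (a₁ : ℝ) (hL : 0 < L) (hδ : 0 < δ) (j : ℕ) :
    leftEnd a₁ L j < rightEnd a₁ L δ j := by
  unfold rightEnd
  linarith

theorem derivWithin_of_eqOn_expWave (hL : 0 < L) (hδ : 0 < δ)
    (h : Set.EqOn (w j) (expWave z A B (leftEnd a₁ L j)) (subdomain a₁ L δ j)) {x : ℝ}
    (hx : x ∈ subdomain a₁ L δ j) :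
    derivWithin (w j) (subdomain a₁ L δ j) x =
      expWave z (z * A) (-(z * B)) (leftEnd a₁ L j) x := by
  rw [derivWithin_congr h (h hx)]
  exact (hasDerivAt_expWave z A B _ x).hasDerivWithinAt.derivWithin
    (uniqueDiffOn_Icc (leftEnd_lt_rightEnd a₁ hL hδ j) x hx)

theorem robinLeft_of_eqOn (k : ℝ) (hL : 0 < L) (hδ : 0 < δ)
    (h : Set.EqOn (w j) (expWave z A B (leftEnd a₁ L j)) (subdomain a₁ L δ j)) {t : ℝ}
    (ht0 : 0 ≤ t) (ht : t ≤ L + 2 * δ) :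
    robinLeft a₁ k L δ w j (leftEnd a₁ L j + t) =
      -((z - Complex.I * k) * A * Complex.exp (z * t)) +
        (z + Complex.I * k) * B * Complex.exp (-(z * t)) := by
  have hx : leftEnd a₁ L j + t ∈ subdomain a₁ L δ j := by
    unfold subdomain rightEnd
    constructor <;> linarith
  unfold robinLeft
  rw [derivWithin_of_eqOn_expWave hL hδ h hx, h hx]
  simp only [expWave, Complex.ofReal_add, add_sub_cancel_left]
  ring

theorem robinRight_of_eqOn (k : ℝ) (hL : 0 < L) (hδ : 0 < δ)
    (h : Set.EqOn (w j) (expWave z A B (leftEnd a₁ L j)) (subdomain a₁ L δ j)) {t : ℝ}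
    (ht0 : 0 ≤ t) (ht : t ≤ L + 2 * δ) :
    robinRight a₁ k L δ w j (leftEnd a₁ L j + t) =
      (z + Complex.I * k) * A * Complex.exp (z * t) -
        (z - Complex.I * k) * B * Complex.exp (-(z * t)) := by
  have hx : leftEnd a₁ L j + t ∈ subdomain a₁ L δ j := by
    unfold subdomain rightEnd
    constructor <;> linarith
  unfold robinRight
  rw [derivWithin_of_eqOn_expWave hL hδ h hx, h hx]
  simp only [expWave, Complex.ofReal_add, add_sub_cancel_left]
  ring

theorem rightEnd_eq (a₁ L δ : ℝ) (j : ℕ) :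
    rightEnd a₁ L δ j = leftEnd a₁ L j + (L + 2 * δ) := by
  unfold rightEnd; ring

theorem rightEnd_eq_succ (a₁ L δ : ℝ) (j : ℕ) :
    rightEnd a₁ L δ j = leftEnd a₁ L (j + 1) + 2 * δ := by
  unfold rightEnd leftEnd; push_cast; ring

theorem leftEnd_succ (a₁ L : ℝ) (j : ℕ) : leftEnd a₁ L (j + 1) = leftEnd a₁ L j + L := by
  unfold leftEnd; push_cast; ring

variable {σ kt : ℝ}

/-- The data leaving a subdomain to the left, in terms of the data entering it. -/
theorem robinRight_interior (hk : 0 < k) (hσ : 0 < σ) (hL : 0 < L) (hδ : 0 < δ)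
    (h : Set.EqOn (w j) (expWave (zeta k σ kt) A B (leftEnd a₁ L j)) (subdomain a₁ L δ j)) :
    robinRight a₁ k L δ w j (leftEnd a₁ L j + 2 * δ) =
      coeffB k σ L δ kt * robinLeft a₁ k L δ w j (leftEnd a₁ L j) +
        coeffA k σ L δ kt * robinRight a₁ k L δ w j (rightEnd a₁ L δ j) := by
  have h1 := robinLeft_of_eqOn k hL hδ h le_rfl (by positivity)
  simp only [add_zero] at h1
  rw [rightEnd_eq, robinRight_of_eqOn k hL hδ h (by positivity) le_rfl,
    robinRight_of_eqOn k hL hδ h (by positivity) (by linarith), h1]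
  have hD := coeffDen_ne_zero hk hσ hL hδ kt
  unfold coeffA coeffB
  rw [div_mul_eq_mul_div, div_mul_eq_mul_div, ← add_div, eq_div_iff hD]
  unfold coeffDen
  set z := zeta k σ kt
  push_cast
  rw [show z * (2 * δ + L) = 2 * z * δ + z * L by ring,
    show z * (L + 2 * δ) = 2 * z * δ + z * L by ring, show z * (2 * (δ : ℂ)) = 2 * z * δ by ring,
    mul_zero, neg_zero, Complex.exp_zero, neg_add, Complex.exp_add, Complex.exp_add]
  have h2 : Complex.exp (2 * z * δ) * Complex.exp (-(2 * z * δ)) = 1 := by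
    rw [← Complex.exp_add]; simp
  have h3 : Complex.exp (z * L) * Complex.exp (-(z * L)) = 1 := by
    rw [← Complex.exp_add]; simp
  set e := Complex.exp (2 * z * δ)
  set e' := Complex.exp (-(2 * z * δ))
  set f := Complex.exp (z * L)
  set f' := Complex.exp (-(z * L))
  set p := z + Complex.I * k with hp
  set q := z - Complex.I * k with hq
  rw [show z ^ 2 - (Complex.I * k) ^ 2 = p * q by rw [hp, hq]; ring]
  linear_combination (p * q ^ 2 * A * (f - f') - p ^ 2 * q * B * (f - f')) * h2

/-- The data leaving a subdomain to the right, in terms of the data entering it. -/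
theorem robinLeft_interior (hk : 0 < k) (hσ : 0 < σ) (hL : 0 < L) (hδ : 0 < δ)
    (h : Set.EqOn (w j) (expWave (zeta k σ kt) A B (leftEnd a₁ L j)) (subdomain a₁ L δ j)) :
    robinLeft a₁ k L δ w j (leftEnd a₁ L j + L) =
      coeffB k σ L δ kt * robinRight a₁ k L δ w j (rightEnd a₁ L δ j) +
        coeffA k σ L δ kt * robinLeft a₁ k L δ w j (leftEnd a₁ L j) := by
  have h1 := robinLeft_of_eqOn k hL hδ h le_rfl (by positivity)
  simp only [add_zero] at h1
  rw [rightEnd_eq, robinRight_of_eqOn k hL hδ h (by positivity) le_rfl,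
    robinLeft_of_eqOn k hL hδ h (by positivity) (by linarith), h1]
  have hD := coeffDen_ne_zero hk hσ hL hδ kt
  unfold coeffA coeffB
  rw [div_mul_eq_mul_div, div_mul_eq_mul_div, ← add_div, eq_div_iff hD]
  unfold coeffDen
  set z := zeta k σ kt
  push_cast
  rw [show z * (2 * δ + L) = 2 * z * δ + z * L by ring,
    show z * (L + 2 * δ) = 2 * z * δ + z * L by ring,
    mul_zero, neg_zero, Complex.exp_zero, neg_add, Complex.exp_add, Complex.exp_add]
  have h3 : Complex.exp (z * L) * Complex.exp (-(z * L)) = 1 := by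
    rw [← Complex.exp_add]; simp
  set e := Complex.exp (2 * z * δ)
  set e' := Complex.exp (-(2 * z * δ))
  set f := Complex.exp (z * L)
  set f' := Complex.exp (-(z * L))
  set p := z + Complex.I * k with hp
  set q := z - Complex.I * k with hq
  rw [show z ^ 2 - (Complex.I * k) ^ 2 = p * q by rw [hp, hq]; ring]
  linear_combination (q ^ 3 * A * e' + p ^ 3 * B * e - p ^ 2 * q * A * e - p * q ^ 2 * B * e') * h3

end traces

/-! ### One Schwarz sweep: action on the data and solvability -/

section sweep

variable {a₁ k σ L δ kt : ℝ} {N : ℕ} {v w : ℕ → ℝ → ℂ}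

theorem IsSweep.exists_eqOn (hk : 0 < k) (hσ : 0 < σ) (hL : 0 < L) (hδ : 0 < δ)
    (h : IsSweep a₁ k σ L δ kt N v w) {j : ℕ} (h1 : 1 ≤ j) (h2 : j ≤ N) :
    ∃ A B : ℂ, Set.EqOn (w j) (expWave (zeta k σ kt) A B (leftEnd a₁ L j))
      (subdomain a₁ L δ j) := by
  refine exists_eq_expWave (zeta_ne_zero (mul_pos hk hσ) kt) (leftEnd_lt_rightEnd a₁ hL hδ j)
    (h.smooth j h1 h2) fun x hx => ?_
  rw [zeta_sq]
  exact h.ode j h1 h2 x hx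

theorem IsSweep.interfaceData_eq (hk : 0 < k) (hσ : 0 < σ) (hL : 0 < L) (hδ : 0 < δ) (hN : 2 ≤ N)
    (h : IsSweep a₁ k σ L δ kt N v w) :
    interfaceData a₁ k L δ N w =
      (iterMatrix k σ L δ kt N).mulVec (interfaceData a₁ k L δ N v) := by
  -- X i and Y i are the data entering subdomain i + 1 from the right and from the left; the zeros
  -- at i = N - 1 and i = 0 encode the outer boundary conditions.
  set X : ℕ → ℂ := fun i => if i = N - 1 then 0 else
    robinRight a₁ k L δ v (i + 2) (rightEnd a₁ L δ (i + 1)) with hX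
  set Y : ℕ → ℂ := fun i => if i = 0 then 0 else
    robinLeft a₁ k L δ v i (leftEnd a₁ L (i + 1)) with hY
  have hv : interfaceData a₁ k L δ N v = interleave X Y (N - 1) := by
    ext ⟨i, r⟩
    have hi := i.2.ne
    fin_cases r <;> simp [interfaceData, interleave, hX, hY, hi]
  have hXw : ∀ j, 1 ≤ j → j ≤ N → robinRight a₁ k L δ w j (rightEnd a₁ L δ j) = X (j - 1) := by
    intro j h1 h2
    obtain ⟨i, rfl⟩ := Nat.exists_eq_add_of_le' h1
    simp only [hX, Nat.add_sub_cancel]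
    split_ifs with hj
    · obtain rfl : i + 1 = N := by omega
      exact h.right_end
    · exact h.right (i + 1) h1 (by omega)
  have hYw : ∀ j, 1 ≤ j → j ≤ N → robinLeft a₁ k L δ w j (leftEnd a₁ L j) = Y (j - 1) := by
    intro j h1 h2
    obtain ⟨i, rfl⟩ := Nat.exists_eq_add_of_le' h1
    simp only [hY, Nat.add_sub_cancel]
    split_ifs with hj
    · subst hj
      exact h.left_end
    · exact h.left (i + 1) (by omega) h2
  rw [hv, iterMatrix, blockToeplitz_mulVec_interleave _ _ (by simp [hX]) (by simp [hY])]
  ext ⟨i, r⟩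
  have hi := i.2
  fin_cases r
  · have hj : (i : ℕ) + 2 ≤ N := by omega
    obtain ⟨A, B, hAB⟩ := h.exists_eqOn hk hσ hL hδ (j := (i : ℕ) + 2) (by omega) hj
    have e := robinRight_interior hk hσ hL hδ hAB
    rw [hXw _ (by omega) hj, hYw _ (by omega) hj] at e
    simpa [interfaceData, interleave, rightEnd_eq_succ] using e
  · have hj : (i : ℕ) + 1 ≤ N := by omega
    obtain ⟨A, B, hAB⟩ := h.exists_eqOn hk hσ hL hδ (j := (i : ℕ) + 1) (by omega) hj
    have e := robinLeft_interior hk hσ hL hδ hAB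
    rw [hXw _ (by omega) hj, hYw _ (by omega) hj] at e
    simpa [interfaceData, interleave, leftEnd_succ a₁ L ((i : ℕ) + 1)] using e

/-- The local problem with given impedance data. -/
theorem exists_expWave_coeff (hk : 0 < k) (hσ : 0 < σ) (hL : 0 < L) (hδ : 0 < δ) (c d : ℂ) :
    ∃ A B : ℂ, -((zeta k σ kt - Complex.I * k) * A) + (zeta k σ kt + Complex.I * k) * B = c ∧
      (zeta k σ kt + Complex.I * k) * A * Complex.exp (zeta k σ kt * (2 * δ + L)) -
        (zeta k σ kt - Complex.I * k) * B * Complex.exp (-(zeta k σ kt * (2 * δ + L))) = d := by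
  have hD := coeffDen_ne_zero hk hσ hL hδ kt
  have hDe : coeffDen k σ L δ kt = _ := coeffDen.eq_1 k σ L δ kt
  set D := coeffDen k σ L δ kt
  set z := zeta k σ kt
  set p := z + Complex.I * k
  set q := z - Complex.I * k
  have h1 : Complex.exp (z * (2 * δ + L)) * Complex.exp (-(z * (2 * δ + L))) = 1 := by
    rw [← Complex.exp_add]; simp
  set E := Complex.exp (z * (2 * δ + L))
  set E' := Complex.exp (-(z * (2 * δ + L)))
  -- Cramer's rule; the determinant of the system is -D.
  refine ⟨(q * E' * c + p * d) / D, (q * d + p * E * c) / D, ?_, ?_⟩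
  · field_simp
    linear_combination -c * hDe
  · field_simp
    linear_combination -d * hDe

theorem exists_isSweep (hk : 0 < k) (hσ : 0 < σ) (hL : 0 < L) (hδ : 0 < δ) (v : ℕ → ℝ → ℂ) :
    ∃ w, IsSweep a₁ k σ L δ kt N v w := by
  choose A B hA hB using exists_expWave_coeff (kt := kt) hk hσ hL hδ
  set c : ℕ → ℂ := fun j => if j = 1 then 0 else robinLeft a₁ k L δ v (j - 1) (leftEnd a₁ L j)
  set d : ℕ → ℂ := fun j => if j = N then 0 else
    robinRight a₁ k L δ v (j + 1) (rightEnd a₁ L δ j)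
  set w : ℕ → ℝ → ℂ := fun j => expWave (zeta k σ kt) (A (c j) (d j)) (B (c j) (d j))
    (leftEnd a₁ L j)
  have hl : ∀ j, robinLeft a₁ k L δ w j (leftEnd a₁ L j) = c j := by
    intro j
    have h := robinLeft_of_eqOn (w := w) (j := j) (a₁ := a₁) k hL hδ (fun x _ => rfl) le_rfl
      (by positivity)
    rw [add_zero] at h
    rw [h]
    simpa using hA (c j) (d j)
  have hr : ∀ j, robinRight a₁ k L δ w j (rightEnd a₁ L δ j) = d j := by
    intro j
    rw [rightEnd_eq, robinRight_of_eqOn (w := w) (j := j) k hL hδ (fun x _ => rfl)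
      (by positivity) le_rfl]
    push_cast
    rw [add_comm (L : ℂ)]
    exact hB (c j) (d j)
  refine ⟨w, fun j _ _ => (contDiff_expWave _ _ _ _).contDiffOn, fun j _ _ x _ => ?_,
    fun j h1 _ => ?_, fun j _ h2 => ?_, ?_, ?_⟩
  · simp only [w]
    rw [← zeta_sq, deriv_expWave, deriv_expWave]
    unfold expWave
    ring
  · rw [hl]; exact if_neg (by omega)
  · rw [hr]; exact if_neg (by omega)
  · rw [hl]; exact if_pos rfl
  · rw [hr]; exact if_pos rfl

end sweep


/-! ### The supremum over all modes -/

section supremum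

variable {σ L δ : ℝ}

theorem bddAbove_modeRate (hσ : 0 < σ) (hL : 0 < L) (hδ : 0 < δ) :
    BddAbove (modeRate 1 σ L δ '' Set.Ici 0) := by
  obtain ⟨q, hq, -⟩ := exists_bound_of_tendsto_zero (continuous_modeRate one_pos hσ hL hδ)
    (tendsto_modeRate_atTop hσ hL hδ)
  exact ⟨q, Set.forall_mem_image.2 hq⟩

theorem bddAbove_factor1d (hσ : 0 < σ) (hL : 0 < L) (hδ : 0 < δ) :
    BddAbove (Set.range fun β : Set.Ioi (0 : ℝ) => factor1d 1 σ L δ (Real.sqrt β)) := by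
  refine (bddAbove_modeRate hσ hL hδ).mono ?_
  rintro _ ⟨β, rfl⟩
  exact ⟨_, Real.sqrt_nonneg _, (factor1d_eq one_pos hσ hL hδ _).symm⟩

theorem modeRate_le_supFactor (hσ : 0 < σ) (hL : 0 < L) (hδ : 0 < δ) {κ : ℝ} (hκ : 0 < κ) :
    modeRate 1 σ L δ κ ≤ supFactor σ L δ := by
  have h := le_ciSup (bddAbove_factor1d hσ hL hδ) ⟨κ ^ 2, pow_pos hκ 2⟩
  rwa [Real.sqrt_sq hκ.le, factor1d_eq one_pos hσ hL hδ] at h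

theorem factor1d_mode_eq {k : ℝ} (hk : 0 < k) (hσ : 0 < σ) (hL : 0 < L) (hδ : 0 < δ) (kt : ℝ) :
    factor1d k (σ * k) (L / k) (δ / k) kt = modeRate 1 σ L δ (kt / k) := by
  rw [factor1d_scale hk hσ, factor1d_eq one_pos hσ hL hδ]

theorem factor1d_le_supFactor {k kt : ℝ} (hk : 0 < k) (hσ : 0 < σ) (hL : 0 < L) (hδ : 0 < δ)
    (hkt : 0 < kt) : factor1d k (σ * k) (L / k) (δ / k) kt ≤ supFactor σ L δ := by
  rw [factor1d_mode_eq hk hσ hL hδ]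
  exact modeRate_le_supFactor hσ hL hδ (div_pos hkt hk)

theorem mode_pos {Lhat : ℝ} (hLhat : 0 < Lhat) (m : ℕ+) : 0 < (m : ℕ) * Real.pi / Lhat := by
  have : (0 : ℝ) < (m : ℕ) := by exact_mod_cast m.pos
  have := Real.pi_pos
  positivity

theorem bddAbove_factor1d_modes {Lhat k : ℝ} (hσ : 0 < σ) (hL : 0 < L) (hδ : 0 < δ)
    (hLhat : 0 < Lhat) (hk : 0 < k) :
    BddAbove (Set.range fun m : ℕ+ =>
      factor1d k (σ * k) (L / k) (δ / k) ((m : ℕ) * Real.pi / Lhat)) := by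
  refine ⟨supFactor σ L δ, ?_⟩
  rintro _ ⟨m, rfl⟩
  exact factor1d_le_supFactor hk hσ hL hδ (mode_pos hLhat m)

theorem factor2d_le_supFactor {Lhat k : ℝ} (hσ : 0 < σ) (hL : 0 < L) (hδ : 0 < δ)
    (hLhat : 0 < Lhat) (hk : 0 < k) :
    factor2d Lhat k (σ * k) (L / k) (δ / k) ≤ supFactor σ L δ :=
  ciSup_le fun m => factor1d_le_supFactor hk hσ hL hδ (mode_pos hLhat m)

/-- As `k` grows, the scaled Fourier numbers fill the half line. -/
theorem tendsto_factor2d {Lhat : ℝ} (hσ : 0 < σ) (hL : 0 < L) (hδ : 0 < δ) (hLhat : 0 < Lhat) :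
    Tendsto (fun k : ℝ => factor2d Lhat k (σ * k) (L / k) (δ / k)) atTop
      (𝓝 (supFactor σ L δ)) := by
  have hpi := Real.pi_pos
  refine tendsto_order.2 ⟨fun c hc => ?_, fun c hc => ?_⟩
  · obtain ⟨⟨β, hβ⟩, h⟩ := exists_lt_of_lt_ciSup hc
    have hκ : 0 < Real.sqrt β := Real.sqrt_pos.2 hβ
    simp only [factor1d_eq one_pos hσ hL hδ] at h
    set κ := Real.sqrt β
    -- Rounding up κL̂k/π picks an admissible mode m with mπ/(L̂k) → κ, so continuity of `modeRate`
    -- carries the near-maximal value at κ to this mode.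
    have hlim : Tendsto (fun k : ℝ => (⌈κ * Lhat / Real.pi * k⌉₊ : ℝ) * Real.pi / Lhat / k) atTop
        (𝓝 κ) := by
      have h1 := (tendsto_nat_ceil_mul_div_atTop (R := ℝ) (a := κ * Lhat / Real.pi)
        (by positivity)).mul_const (Real.pi / Lhat)
      rw [show κ * Lhat / Real.pi * (Real.pi / Lhat) = κ by field_simp] at h1
      refine h1.congr fun k => ?_
      ring
    have hev := (((continuous_modeRate one_pos hσ hL hδ).tendsto κ).comp hlim).eventually_const_lt h
    filter_upwards [hev, eventually_gt_atTop 0] with k h1 hk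
    have hm : 0 < ⌈κ * Lhat / Real.pi * k⌉₊ := Nat.ceil_pos.2 (by positivity)
    refine lt_of_lt_of_le h1 ?_
    have h2 := le_ciSup (bddAbove_factor1d_modes hσ hL hδ hLhat hk) ⟨_, hm⟩
    rwa [factor1d_mode_eq hk hσ hL hδ] at h2
  · filter_upwards [eventually_gt_atTop 0] with k hk
    exact (factor2d_le_supFactor hσ hL hδ hLhat hk).trans_lt hc

/-- The pointwise bound also holds at κ = 0, so the supremum over the open half line is controlled
by a maximum on a compact interval together with the bound 1/2 beyond it. -/
theorem supFactor_lt_one (hσ : 0 < σ) (hL : 0 < L) (hδ : 0 < δ)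
    (h : 1 ≤ σ ∨ robustThreshold σ ≤ L ∨ robustThreshold σ ≤ δ) : supFactor σ L δ < 1 := by
  obtain ⟨q, hq, hq'⟩ := exists_bound_of_tendsto_zero (continuous_modeRate one_pos hσ hL hδ)
    (tendsto_modeRate_atTop hσ hL hδ)
  have hq1 : q < 1 := by
    rcases hq' with rfl | ⟨κ, rfl⟩
    · norm_num
    · exact modeRate_lt_one hσ hL hδ (dampingDominates_zeta hσ hL hδ h κ)
  have : Nonempty (Set.Ioi (0 : ℝ)) := ⟨⟨1, Set.mem_Ioi.2 one_pos⟩⟩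
  refine (ciSup_le fun β => ?_).trans_lt hq1
  rw [factor1d_eq one_pos hσ hL hδ]
  exact hq _ (Real.sqrt_nonneg _)

theorem iterRadius_le_supFactor {k kt : ℝ} (hk : 0 < k) (hσ : 0 < σ) (hL : 0 < L) (hδ : 0 < δ)
    (hkt : 0 < kt) (N : ℕ) :
    iterRadius k (σ * k) (L / k) (δ / k) kt N ≤ supFactor σ L δ := by
  rw [iterRadius_scale hk hσ]
  exact (iterRadius_le_modeRate _ _ _ _ _ _).trans
    (modeRate_le_supFactor hσ hL hδ (div_pos hkt hk))

end supremum


end Schwarz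

end

theorem corollary4p2 (σ₀ : ℝ) (hσ₀ : 0 < σ₀) :
    (∀ L₀ δ₀ : ℝ, 0 < L₀ → 0 < δ₀ →
      -- the matrix is the iteration matrix of the Schwarz method, for every Fourier number
      (∀ a₁ k kt : ℝ, 0 < k → 0 < kt → ∀ N : ℕ, 2 ≤ N → ∀ v : ℕ → ℝ → ℂ,
        (∃ w, Schwarz.IsSweep a₁ k (σ₀ * k) (L₀ / k) (δ₀ / k) kt N v w) ∧
        ∀ w, Schwarz.IsSweep a₁ k (σ₀ * k) (L₀ / k) (δ₀ / k) kt N v w →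
          Schwarz.interfaceData a₁ k (L₀ / k) (δ₀ / k) N w =
            Matrix.mulVec (Schwarz.iterMatrix k (σ₀ * k) (L₀ / k) (δ₀ / k) kt N)
              (Schwarz.interfaceData a₁ k (L₀ / k) (δ₀ / k) N v)) ∧
      -- the limit that defines the convergence factor of a mode exists
      (∀ k kt : ℝ, 0 < k → 0 < kt →
        Tendsto (fun N : ℕ => Schwarz.iterRadius k (σ₀ * k) (L₀ / k) (δ₀ / k) kt N) atTop
          (𝓝 (Schwarz.factor1d k (σ₀ * k) (L₀ / k) (δ₀ / k) kt))) ∧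
      -- it depends on the wave number and the Fourier number only through their ratio
      (∀ k β : ℝ, 0 < k → 0 < β →
        Schwarz.factor1d k (σ₀ * k) (L₀ / k) (δ₀ / k) (Real.sqrt β * k) =
          Schwarz.factor1d 1 σ₀ L₀ δ₀ (Real.sqrt β)) ∧
      -- the two suprema are finite, and the wave-number-free one is an upper bound
      BddAbove (Set.range fun β : Set.Ioi (0 : ℝ) =>
        Schwarz.factor1d 1 σ₀ L₀ δ₀ (Real.sqrt β)) ∧
      (∀ Lhat k : ℝ, 0 < Lhat → 0 < k →
        BddAbove (Set.range fun m : ℕ+ =>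
          Schwarz.factor1d k (σ₀ * k) (L₀ / k) (δ₀ / k) ((m : ℕ) * Real.pi / Lhat)) ∧
        Schwarz.factor2d Lhat k (σ₀ * k) (L₀ / k) (δ₀ / k) ≤ Schwarz.supFactor σ₀ L₀ δ₀) ∧
      -- the bound is tight as the wave number grows
      (∀ Lhat : ℝ, 0 < Lhat →
        Tendsto (fun k : ℝ => Schwarz.factor2d Lhat k (σ₀ * k) (L₀ / k) (δ₀ / k)) atTop
          (𝓝 (Schwarz.supFactor σ₀ L₀ δ₀)))) ∧
    -- robustness in the wave number and in the number of subdomains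
    (∃ M : ℝ, ∀ L₀ δ₀ : ℝ, 0 < L₀ → 0 < δ₀ → (1 ≤ σ₀ ∨ M ≤ L₀ ∨ M ≤ δ₀) →
      Schwarz.supFactor σ₀ L₀ δ₀ < 1 ∧
      ∃ q : ℝ, q < 1 ∧ ∃ N₀ : ℕ, ∀ N : ℕ, N₀ ≤ N → ∀ Lhat k : ℝ, 0 < Lhat → 0 < k → ∀ m : ℕ+,
        Schwarz.iterRadius k (σ₀ * k) (L₀ / k) (δ₀ / k) ((m : ℕ) * Real.pi / Lhat) N ≤ q) := by

  refine ⟨fun L₀ δ₀ hL₀ hδ₀ => ⟨fun a₁ k kt hk _ N hN v => ?_, fun k kt hk _ => ?_,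
    fun k β hk _ => ?_, Schwarz.bddAbove_factor1d hσ₀ hL₀ hδ₀, fun Lhat k hLhat hk => ⟨?_, ?_⟩,
    fun Lhat hLhat => Schwarz.tendsto_factor2d hσ₀ hL₀ hδ₀ hLhat⟩,
    Schwarz.robustThreshold σ₀, fun L₀ δ₀ hL₀ hδ₀ h => ⟨?_, ?_⟩⟩
  · have hσ := mul_pos hσ₀ hk
    have hL := div_pos hL₀ hk
    have hδ := div_pos hδ₀ hk
    exact ⟨Schwarz.exists_isSweep hk hσ hL hδ v, fun w hw => hw.interfaceData_eq hk hσ hL hδ hN⟩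
  · have hσ := mul_pos hσ₀ hk
    have hL := div_pos hL₀ hk
    have hδ := div_pos hδ₀ hk
    rw [Schwarz.factor1d_eq hk hσ hL hδ]
    exact Schwarz.tendsto_iterRadius hk hσ hL hδ kt
  · rw [Schwarz.factor1d_scale hk hσ₀, mul_div_cancel_right₀ _ hk.ne']
  · exact Schwarz.bddAbove_factor1d_modes hσ₀ hL₀ hδ₀ hLhat hk
  · exact Schwarz.factor2d_le_supFactor hσ₀ hL₀ hδ₀ hLhat hk
  · exact Schwarz.supFactor_lt_one hσ₀ hL₀ hδ₀ h
  -- S itself serves as q, and N₀ = 0, because max |a ± b| bounds the spectral radius for every N.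
  · exact ⟨_, Schwarz.supFactor_lt_one hσ₀ hL₀ hδ₀ h, 0, fun N _ Lhat k hLhat hk m =>
      Schwarz.iterRadius_le_supFactor hk hσ₀ hL₀ hδ₀ (Schwarz.mode_pos hLhat m) N⟩
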